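/- Let $C=\langle t\rangle$ be the infinite cyclic group, $M$ a $C$-module such that the $\mathbb Q$-vector space $M\otimes\mathbb Q$ is finite dimensional, and $G=M\rtimes C$. For a group $G$ define the lower rational central series by $\gamma_1^{\mathbb Q}G=G$, $\gamma_{i+1}^{\mathbb Q}G=\mathrm{Ker}\bigl(\gamma_i^{\mathbb Q}G\to(\gamma_i^{\mathbb Q}G/[\gamma_i^{\mathbb Q}G,G])\otimes\mathbb Q\bigr)$, and the $\mathbb Q$-completion $\hat G_{\mathbb Q}=\varprojlim_i\,(G/\gamma_i^{\mathbb Q}G)\otimes\mathbb Q$, where $N\otimes\mathbb Q$ denotes the Malcev completion of a nilpotent group $N$, i.e. the universal uniquely divisible group under $N$; let $\iota:G\to\hat G_{\mathbb Q}$ be the canonical homomorphism. Let $I$ be the augmentation ideal of $\mathbb Q[C]$, let $(M\otimes\mathbb Q)^\wedge_I=\varprojlim_n\,(M\otimes\mathbb Q)/I^n(M\otimes\mathbb Q)$, and let the additive group $\mathbb Q$ act on it by $\alpha\cdot x=\sum_{k\ge 0}\binom{\alpha}{k}(t-1)^kx$. Then: 1. There is an isomorphism $\hat G_{\mathbb Q}\cong(M\otimes\mathbb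 Q)^\wedge_I\rtimes\mathbb Q$ under which $\iota(m,t^k)$ corresponds to $(\text{image of }m\otimes 1,\;k)$ for all $m\in M$, $k\in\mathbb Z$. 2. For every $n\ge 0$ the homomorphism $\iota_*:H_n(G,\mathbb Q)\to H_n(\hat G_{\mathbb Q},\mathbb Q)$ is surjective. -/

import Mathlib

open scoped TensorProduct commutatorElement

noncomputable section

universe u

/-! ### Malcev completion (rationalization) -/

/-- A group is uniquely divisible (rational) if each `x ↦ x ^ n`, `n ≥ 1`, is a bijection. -/
def IsUniquelyDivisible (H : Type*) [Group H] : Prop :=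
  ∀ n : ℕ, n ≠ 0 → Function.Bijective (fun x : H => x ^ n)

/-- Formal expressions built from elements of `N` by products, inverses and roots;
`root n a` stands for the `(n + 1)`-st root of `a`. -/
inductive MalcevTerm (N : Type u) : Type u
  | of : N → MalcevTerm N
  | mul : MalcevTerm N → MalcevTerm N → MalcevTerm N
  | inv : MalcevTerm N → MalcevTerm N
  | root : ℕ → MalcevTerm N → MalcevTerm N

namespace MalcevTerm

variable {N : Type u} [Group N]

/-- Formal natural powers. -/
def npow (a : MalcevTerm N) : ℕ → MalcevTerm N
  | 0 => of 1
  | n + 1 => mul (npow a n) a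

/-- The congruence generated by the group axioms, the multiplication of `N`, and the
axioms saying that `root n` is inverse to `x ↦ x ^ (n + 1)`. -/
inductive Rel : MalcevTerm N → MalcevTerm N → Prop
  | refl (a) : Rel a a
  | symm {a b} : Rel a b → Rel b a
  | trans {a b c} : Rel a b → Rel b c → Rel a c
  | mul_congr {a a' b b'} : Rel a a' → Rel b b' → Rel (mul a b) (mul a' b')
  | inv_congr {a a'} : Rel a a' → Rel (inv a) (inv a')
  | root_congr (n) {a a'} : Rel a a' → Rel (root n a) (root n a')
  | mul_assoc (a b c) : Rel (mul (mul a b) c) (mul a (mul b c))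
  | one_mul (a) : Rel (mul (of 1) a) a
  | inv_mul (a) : Rel (mul (inv a) a) (of 1)
  | of_mul (x y : N) : Rel (of (x * y)) (mul (of x) (of y))
  | root_pow (n a) : Rel (npow (root n a) (n + 1)) a
  | pow_root (n a) : Rel (root n (npow a (n + 1))) a

/-- `MalcevTerm.Rel` as a setoid. -/
def setoid (N : Type u) [Group N] : Setoid (MalcevTerm N) :=
  ⟨Rel, Rel.refl, Rel.symm, Rel.trans⟩

end MalcevTerm

/-- The Malcev completion `N ⊗ ℚ` of a nilpotent group `N`: the universal uniquely divisible
group under `N`. It is uniquely divisible (`isUniquelyDivisible`), has the universal property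
(`lift`, `lift_of`, `hom_ext`), and is nilpotent whenever `N` is (`isNilpotent`). -/
def MalcevCompletion (N : Type u) [Group N] : Type u :=
  Quotient (MalcevTerm.setoid N)

namespace MalcevCompletion

open MalcevTerm

variable {N : Type u} [Group N]

instance : Group (MalcevCompletion N) :=
  letI : Mul (MalcevCompletion N) :=
    ⟨Quotient.map₂ MalcevTerm.mul fun _ _ h _ _ h' => Rel.mul_congr h h'⟩
  letI : Inv (MalcevCompletion N) :=
    ⟨Quotient.map MalcevTerm.inv fun _ _ h => Rel.inv_congr h⟩
  letI : One (MalcevCompletion N) := ⟨Quotient.mk (MalcevTerm.setoid N) (MalcevTerm.of 1)⟩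
  Group.ofLeftAxioms
    (by rintro ⟨a⟩ ⟨b⟩ ⟨c⟩; exact Quotient.sound (Rel.mul_assoc a b c))
    (by rintro ⟨a⟩; exact Quotient.sound (Rel.one_mul a))
    (by rintro ⟨a⟩; exact Quotient.sound (Rel.inv_mul a))

/-- The class of an expression. -/
def mk (a : MalcevTerm N) : MalcevCompletion N := Quotient.mk (MalcevTerm.setoid N) a

theorem mk_mul (a b : MalcevTerm N) : mk (a.mul b) = mk a * mk b := rfl

theorem mk_inv (a : MalcevTerm N) : mk a.inv = (mk a)⁻¹ := rfl

theorem mk_npow (a : MalcevTerm N) (n : ℕ) : mk (a.npow n) = mk a ^ n := by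
  induction n with
  | zero => rw [pow_zero]; rfl
  | succ n ih => rw [pow_succ, ← ih]; rfl

/-- The canonical homomorphism `N → N ⊗ ℚ`. -/
def of : N →* MalcevCompletion N where
  toFun x := mk (MalcevTerm.of x)
  map_one' := rfl
  map_mul' x y := Quotient.sound (Rel.of_mul x y)

theorem isUniquelyDivisible : IsUniquelyDivisible (MalcevCompletion N) := by
  intro n hn
  obtain ⟨n, rfl⟩ := Nat.exists_eq_succ_of_ne_zero hn
  constructor
  · rintro ⟨a⟩ ⟨b⟩ h
    have h' : mk a ^ (n + 1) = mk b ^ (n + 1) := h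
    rw [← mk_npow, ← mk_npow] at h'
    have h'' : Rel (a.npow (n + 1)) (b.npow (n + 1)) := Quotient.exact h'
    exact Quotient.sound
      (((Rel.pow_root n a).symm.trans (Rel.root_congr n h'')).trans (Rel.pow_root n b))
  · rintro ⟨a⟩
    refine ⟨mk (a.root n), ?_⟩
    change mk (a.root n) ^ (n + 1) = mk a
    rw [← mk_npow]
    exact Quotient.sound (Rel.root_pow n a)

section Lift

variable {H : Type*} [Group H]

/-- Evaluation of expressions in a uniquely divisible group. -/
def interp (hH : IsUniquelyDivisible H) (f : N →* H) : MalcevTerm N → H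
  | .of x => f x
  | .mul a b => interp hH f a * interp hH f b
  | .inv a => (interp hH f a)⁻¹
  | .root n a => Function.surjInv (hH (n + 1) n.succ_ne_zero).2 (interp hH f a)

theorem interp_npow (hH : IsUniquelyDivisible H) (f : N →* H) (a : MalcevTerm N) (n : ℕ) :
    interp hH f (a.npow n) = interp hH f a ^ n := by
  induction n with
  | zero => simp [npow, interp]
  | succ n ih => rw [pow_succ, ← ih]; rfl

theorem interp_congr (hH : IsUniquelyDivisible H) (f : N →* H) {a b : MalcevTerm N}
    (h : Rel a b) : interp hH f a = interp hH f b := by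
  induction h with
  | refl a => rfl
  | symm _ ih => exact ih.symm
  | trans _ _ ih₁ ih₂ => exact ih₁.trans ih₂
  | mul_congr _ _ ih₁ ih₂ => simp only [interp, ih₁, ih₂]
  | inv_congr _ ih => simp only [interp, ih]
  | root_congr n _ ih => simp only [interp, ih]
  | mul_assoc a b c => simp only [interp, _root_.mul_assoc]
  | one_mul a => simp [interp]
  | inv_mul a => simp [interp]
  | of_mul x y => simp [interp]
  | root_pow n a =>
    rw [interp_npow]
    exact Function.surjInv_eq (hH (n + 1) n.succ_ne_zero).2 _
  | pow_root n a =>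
    apply (hH (n + 1) n.succ_ne_zero).1
    change interp hH f (root n (a.npow (n + 1))) ^ (n + 1) = interp hH f a ^ (n + 1)
    rw [← interp_npow hH f a]
    exact Function.surjInv_eq (hH (n + 1) n.succ_ne_zero).2 _

/-- A homomorphism from `N` to a uniquely divisible group extends to `N ⊗ ℚ`. -/
def lift (hH : IsUniquelyDivisible H) (f : N →* H) : MalcevCompletion N →* H where
  toFun := Quotient.lift (interp hH f) fun _ _ h => interp_congr hH f h
  map_one' := f.map_one
  map_mul' := by rintro ⟨a⟩ ⟨b⟩; rfl

theorem lift_of (hH : IsUniquelyDivisible H) (f : N →* H) (x : N) : lift hH f (of x) = f x := rfl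

theorem mem_of_closed (S : Subgroup (MalcevCompletion N)) (hof : ∀ x : N, of x ∈ S)
    (hroot : ∀ (n : ℕ) (y : MalcevCompletion N), n ≠ 0 → y ^ n ∈ S → y ∈ S)
    (y : MalcevCompletion N) : y ∈ S := by
  obtain ⟨a, rfl⟩ : ∃ a, mk a = y := Quotient.exists_rep y
  induction a with
  | of x => exact hof x
  | mul a b iha ihb => exact S.mul_mem iha ihb
  | inv a ih => exact S.inv_mem ih
  | root n a ih =>
    refine hroot (n + 1) _ n.succ_ne_zero ?_
    rw [← mk_npow]
    have : mk ((a.root n).npow (n + 1)) = mk a := Quotient.sound (Rel.root_pow n a)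
    rwa [this]

theorem hom_ext (hH : IsUniquelyDivisible H) {f g : MalcevCompletion N →* H}
    (h : ∀ x : N, f (of x) = g (of x)) : f = g := by
  ext y
  refine mem_of_closed (f.eqLocus g) h (fun n y hn hy => ?_) y
  apply (hH n hn).1
  change f (y ^ n) = g (y ^ n) at hy
  simpa using hy

end Lift

/-- A uniquely divisible group generated, as such, by the image of a nilpotent group is
nilpotent. -/
theorem isNilpotent_of_generated (N : Type u) [Group N] [Group.IsNilpotent N] :
    ∀ (H : Type u) [Group H], IsUniquelyDivisible H → ∀ f : N →* H,
      (∀ S : Subgroup H, (∀ x, f x ∈ S) → (∀ (n : ℕ) (y : H), n ≠ 0 → y ^ n ∈ S → y ∈ S) →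
        S = ⊤) → Group.IsNilpotent H := by
  refine Group.nilpotent_center_quotient_ind (P := fun N _ _ =>
    ∀ (H : Type u) [Group H], IsUniquelyDivisible H → ∀ f : N →* H,
      (∀ S : Subgroup H, (∀ x, f x ∈ S) → (∀ (n : ℕ) (y : H), n ≠ 0 → y ^ n ∈ S → y ∈ S) →
        S = ⊤) → Group.IsNilpotent H) N ?_ ?_
  · intro N _ _ H _ hH f hgen
    have hbot : (⊥ : Subgroup H) = ⊤ := by
      refine hgen ⊥ (fun x => ?_) (fun n y hn hy => ?_)
      · rw [Subsingleton.elim x 1, map_one]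
        exact one_mem _
      · rw [Subgroup.mem_bot] at hy ⊢
        exact (hH n hn).1 (by simpa using hy)
    have : Subsingleton H := (Subgroup.subsingleton_iff (G := H)).mp
      (subsingleton_iff_bot_eq_top.mp hbot)
    infer_instance
  · intro N _ _ ih H _ hH f hgen
    have comm_root : ∀ (n : ℕ) (x y : H), n ≠ 0 → Commute x (y ^ n) → Commute x y := by
      intro n x y hn h
      have h1 : (x * y * x⁻¹) ^ n = y ^ n := by
        rw [conj_pow, h.eq, mul_inv_cancel_right]
      have h2 : x * y * x⁻¹ = y := (hH n hn).1 h1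
      exact mul_inv_eq_iff_eq_mul.mp h2
    have hcent : ∀ z ∈ Subgroup.center N, f z ∈ Subgroup.center H := by
      intro z hz
      have hS := hgen (Subgroup.centralizer {f z}) (fun x => ?_) (fun n y hn hy => ?_)
      · rw [Subgroup.mem_center_iff]
        intro g
        have hg : g ∈ Subgroup.centralizer {f z} := hS ▸ Subgroup.mem_top g
        exact (Subgroup.mem_centralizer_singleton_iff.mp hg)
      · rw [Subgroup.mem_centralizer_singleton_iff, ← map_mul, ← map_mul,
          Subgroup.mem_center_iff.mp hz x]
      · rw [Subgroup.mem_centralizer_singleton_iff] at hy ⊢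
        exact (comm_root n (f z) y hn hy.symm).symm
    have hroot : ∀ (n : ℕ) (y : H), n ≠ 0 → y ^ n ∈ Subgroup.center H →
        y ∈ Subgroup.center H := by
      intro n y hn hy
      rw [Subgroup.mem_center_iff] at hy ⊢
      intro g
      exact comm_root n g y hn (hy g)
    have hQ : IsUniquelyDivisible (H ⧸ Subgroup.center H) := by
      intro n hn
      constructor
      · rintro ⟨x⟩ ⟨y⟩ hxy
        have h1 : (x ^ n)⁻¹ * y ^ n ∈ Subgroup.center H := by
          rw [← QuotientGroup.eq]
          exact hxy
        obtain ⟨w, hw⟩ := (hH n hn).2 ((x ^ n)⁻¹ * y ^ n)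
        have hw' : w ^ n = (x ^ n)⁻¹ * y ^ n := hw
        have hwc : w ∈ Subgroup.center H := hroot n w hn (hw' ▸ h1)
        have h2 : (x * w) ^ n = y ^ n := by
          rw [Commute.mul_pow (Subgroup.mem_center_iff.mp hwc x), hw', mul_inv_cancel_left]
        have h3 : x * w = y := (hH n hn).1 h2
        refine QuotientGroup.eq.mpr ?_
        rw [← h3, inv_mul_cancel_left]
        exact hwc
      · rintro ⟨x⟩
        obtain ⟨w, hw⟩ := (hH n hn).2 x
        refine ⟨QuotientGroup.mk w, ?_⟩
        change QuotientGroup.mk (w ^ n) = QuotientGroup.mk x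
        exact congrArg _ hw
    refine Group.of_quotient_center_nilpotent (ih (H ⧸ Subgroup.center H) hQ
      (QuotientGroup.map _ _ f hcent) (fun S hS hSr => ?_))
    have hc := hgen (S.comap (QuotientGroup.mk' _))
      (fun x => hS (QuotientGroup.mk x)) (fun n y hn hy => hSr n _ hn (by simpa using hy))
    rw [eq_top_iff]
    rintro ⟨y⟩ _
    have hy : y ∈ S.comap (QuotientGroup.mk' (Subgroup.center H)) := hc ▸ Subgroup.mem_top y
    exact hy

theorem isNilpotent [Group.IsNilpotent N] : Group.IsNilpotent (MalcevCompletion N) :=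
  isNilpotent_of_generated N _ isUniquelyDivisible of fun S hS hSr =>
    eq_top_iff.mpr fun y _ => mem_of_closed S hS hSr y

/-- Functoriality of the Malcev completion. -/
def map {N' : Type u} [Group N'] (f : N →* N') : MalcevCompletion N →* MalcevCompletion N' :=
  lift isUniquelyDivisible (of.comp f)

theorem map_of {N' : Type u} [Group N'] (f : N →* N') (x : N) : map f (of x) = of (f x) := rfl

end MalcevCompletion

/-! ### The lower rational central series and the `ℚ`-completion of a group -/

section Series

variable {G : Type u} [Group G]

/-- For a normal subgroup `H` of `G`, the abelian group `H / [H, G]`. -/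
abbrev CentralQuotient (H : Subgroup G) [H.Normal] : Type u :=
  H ⧸ (⁅H, (⊤ : Subgroup G)⁆.subgroupOf H)

theorem centralQuotient_mk_mul_comm (H : Subgroup G) [H.Normal] (x y : H) :
    (QuotientGroup.mk (x * y) : CentralQuotient H) = QuotientGroup.mk (y * x) := by
  rw [QuotientGroup.eq]
  have h : ⁅(y⁻¹ : G), (x⁻¹ : G)⁆ ∈ ⁅H, (⊤ : Subgroup G)⁆ :=
    Subgroup.commutator_mem_commutator (H.inv_mem y.2) (Subgroup.mem_top _)
  rw [Subgroup.mem_subgroupOf]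
  simpa [commutatorElement_def, mul_assoc] using h

instance (H : Subgroup G) [H.Normal] : CommGroup (CentralQuotient H) :=
  { (inferInstance : Group (CentralQuotient H)) with
    mul_comm := by
      rintro ⟨x⟩ ⟨y⟩
      exact centralQuotient_mk_mul_comm H x y }

/-- The homomorphism `H → H / [H, G] → (H / [H, G]) ⊗ ℚ`. -/
def toRationalCentralQuotient (H : Subgroup G) [H.Normal] :
    H →* Multiplicative (Additive (CentralQuotient H) ⊗[ℤ] ℚ) where
  toFun h := Multiplicative.ofAdd
    (Additive.ofMul (QuotientGroup.mk h : CentralQuotient H) ⊗ₜ[ℤ] (1 : ℚ))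
  map_one' := by
    rw [QuotientGroup.mk_one, ofMul_one, TensorProduct.zero_tmul, ofAdd_zero]
  map_mul' x y := by
    rw [QuotientGroup.mk_mul, ofMul_mul, TensorProduct.add_tmul, ofAdd_add]

/-- The subgroup `Ker (H → (H / [H, G]) ⊗ ℚ)` of `G`. -/
def rationalCentralStep (H : Subgroup G) [H.Normal] : Subgroup G :=
  (toRationalCentralQuotient H).ker.map H.subtype

instance rationalCentralStep_normal (H : Subgroup G) [hH : H.Normal] :
    (rationalCentralStep H).Normal := by
  constructor
  rintro _ ⟨x, hx, rfl⟩ g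
  refine ⟨⟨g * x * g⁻¹, hH.conj_mem x x.2 g⟩, ?_, rfl⟩
  have key : (QuotientGroup.mk (⟨g * x * g⁻¹, hH.conj_mem x x.2 g⟩ : H) : CentralQuotient H)
      = QuotientGroup.mk x := by
    rw [eq_comm, QuotientGroup.eq, Subgroup.mem_subgroupOf]
    have h : ⁅((x⁻¹ : H) : G), g⁆ ∈ ⁅H, (⊤ : Subgroup G)⁆ :=
      Subgroup.commutator_mem_commutator (x⁻¹).2 (Subgroup.mem_top _)
    simpa [commutatorElement_def, mul_assoc] using h
  have hx' : toRationalCentralQuotient H x = 1 := hx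
  change toRationalCentralQuotient H _ = 1
  rw [← hx']
  simp only [toRationalCentralQuotient, MonoidHom.coe_mk, OneHom.coe_mk, key]

theorem rationalCentralStep_le (H : Subgroup G) [H.Normal] : rationalCentralStep H ≤ H := by
  rintro _ ⟨x, _, rfl⟩
  exact x.2

/-- The lower rational central series as normal subgroups: `0 ↦ G` and
`i + 1 ↦ Ker (γ i → (γ i / [γ i, G]) ⊗ ℚ)`. The numbering starts at `0` rather than at `1`. -/
def rationalLCSAux (G : Type u) [Group G] : ℕ → {H : Subgroup G // H.Normal}
  | 0 => ⟨⊤, inferInstance⟩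
  | i + 1 =>
    haveI := (rationalLCSAux G i).2
    ⟨rationalCentralStep (rationalLCSAux G i).1, inferInstance⟩

/-- The lower rational central series of `G`. -/
def rationalLCS (G : Type u) [Group G] (i : ℕ) : Subgroup G := (rationalLCSAux G i).1

instance (i : ℕ) : (rationalLCS G i).Normal := (rationalLCSAux G i).2

theorem rationalLCS_zero : rationalLCS G 0 = ⊤ := rfl

theorem rationalLCS_succ (i : ℕ) :
    rationalLCS G (i + 1) = rationalCentralStep (rationalLCS G i) := rfl

theorem rationalLCS_succ_le (i : ℕ) : rationalLCS G (i + 1) ≤ rationalLCS G i :=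
  haveI := (rationalLCSAux G i).2
  rationalCentralStep_le _

/-- The transition map `(G / γ (i + 1)) ⊗ ℚ → (G / γ i) ⊗ ℚ`. -/
def completionTransition (G : Type u) [Group G] (i : ℕ) :
    MalcevCompletion (G ⧸ rationalLCS G (i + 1)) →* MalcevCompletion (G ⧸ rationalLCS G i) :=
  MalcevCompletion.map
    (QuotientGroup.map (rationalLCS G (i + 1)) (rationalLCS G i) (MonoidHom.id G)
      (rationalLCS_succ_le i))

/-- The `ℚ`-completion of a group: the inverse limit of the groups `(G / γ i) ⊗ ℚ`. -/
def RationalCompletion (G : Type u) [Group G] :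
    Subgroup (∀ i : ℕ, MalcevCompletion (G ⧸ rationalLCS G i)) where
  carrier := {x | ∀ i, completionTransition G i (x (i + 1)) = x i}
  one_mem' i := map_one _
  mul_mem' {x y} hx hy i := by
    rw [Pi.mul_apply, Pi.mul_apply, map_mul, hx i, hy i]
  inv_mem' {x} hx i := by
    rw [Pi.inv_apply, Pi.inv_apply, map_inv, hx i]

/-- The canonical homomorphism from a group to its `ℚ`-completion. -/
def toRationalCompletion (G : Type u) [Group G] : G →* RationalCompletion G where
  toFun g := ⟨fun _ => MalcevCompletion.of (QuotientGroup.mk g), fun _ => rfl⟩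
  map_one' := Subtype.ext (funext fun _ => map_one MalcevCompletion.of)
  map_mul' x y := Subtype.ext (funext fun _ => map_mul MalcevCompletion.of
    (QuotientGroup.mk x) (QuotientGroup.mk y))

end Series

/-! ### Rational homology -/

/-- The homomorphism `H_n(G, ℚ) → H_n(H, ℚ)` induced by a group homomorphism. -/
def rationalHomologyMap {G H : Type} [Group G] [Group H] (f : G →* H) (n : ℕ) :
    groupHomology (Rep.trivial ℚ G ℚ) n ⟶ groupHomology (Rep.trivial ℚ H ℚ) n :=
  groupHomology.map f (CategoryTheory.CategoryStruct.id (Rep.trivial ℚ G ℚ)) n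

/-! ### Modules over the infinite cyclic group -/

/-- The infinite cyclic group `C`, with generator `t = Multiplicative.ofAdd 1`. -/
abbrev InfCyclic : Type := Multiplicative ℤ

/-- The group ring `ℚ[C]`. -/
abbrev RatGroupRing : Type := MonoidAlgebra ℚ InfCyclic

/-- The augmentation ideal of `ℚ[C]`. -/
def augIdeal : Ideal RatGroupRing :=
  RingHom.ker (MonoidAlgebra.lift ℚ ℚ InfCyclic (1 : InfCyclic →* ℚ))

/-- The element `t - 1` of `ℚ[C]`. -/
def tSubOne : RatGroupRing := MonoidAlgebra.of ℚ InfCyclic (Multiplicative.ofAdd 1) - 1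

theorem tSubOne_mem : tSubOne ∈ augIdeal := by
  simp [augIdeal, tSubOne, RingHom.mem_ker]

/-- The representative `∑_{k < n} (α choose k) (t - 1) ^ k` of `t ^ α` modulo `I ^ n`. -/
def truncPow (α : ℚ) (n : ℕ) : RatGroupRing :=
  ∑ k ∈ Finset.range n, Ring.choose α k • tSubOne ^ k

theorem truncPow_eq (α : ℚ) (n : ℕ) : truncPow α n =
    Polynomial.aeval tSubOne (PowerSeries.trunc n (PowerSeries.binomialSeries ℚ α)) := by
  rw [Polynomial.aeval_def, PowerSeries.eval₂_trunc_eq_sum_range]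
  simp [truncPow, Algebra.smul_def]

theorem aeval_trunc_sub_mem (n : ℕ) (p : Polynomial ℚ) :
    Polynomial.aeval tSubOne p - Polynomial.aeval tSubOne (PowerSeries.trunc n (p : PowerSeries ℚ))
      ∈ augIdeal ^ n := by
  rw [← map_sub]
  have h : (Polynomial.X : Polynomial ℚ) ^ n ∣ p - PowerSeries.trunc n (p : PowerSeries ℚ) := by
    rw [Polynomial.X_pow_dvd_iff]
    intro d hd
    simp [PowerSeries.coeff_trunc, hd]
  obtain ⟨q, hq⟩ := h
  rw [hq, map_mul, map_pow, Polynomial.aeval_X]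
  exact Ideal.mul_mem_right _ _ (Ideal.pow_mem_pow tSubOne_mem n)

theorem truncPow_sub_mem (α : ℚ) {m n : ℕ} (h : m ≤ n) :
    truncPow α n - truncPow α m ∈ augIdeal ^ m := by
  rw [truncPow_eq, truncPow_eq, ← PowerSeries.trunc_trunc_of_le _ h]
  exact aeval_trunc_sub_mem m _

theorem truncPow_add_mem (α β : ℚ) (n : ℕ) :
    truncPow α n * truncPow β n - truncPow (α + β) n ∈ augIdeal ^ n := by
  rw [truncPow_eq, truncPow_eq, truncPow_eq, PowerSeries.binomialSeries_add,
    ← PowerSeries.trunc_trunc_mul_trunc, ← map_mul, ← Polynomial.coe_mul]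
  exact aeval_trunc_sub_mem n _

/-- The element `t ^ α = ∑ (α choose k) (t - 1) ^ k` of the completed group ring `ℚ[C]^_I`. -/
def ratPow (α : ℚ) : AdicCompletion augIdeal RatGroupRing :=
  ⟨fun n => Submodule.Quotient.mk (truncPow α n), by
    intro m n hmn
    refine (Submodule.Quotient.eq _).2 ?_
    simpa using truncPow_sub_mem α hmn⟩

theorem ratPow_zero : ratPow 0 = 1 := by
  ext n
  rw [AdicCompletion.val_one]
  refine (Submodule.Quotient.eq _).2 ?_
  have h := truncPow_sub_mem 0 (Nat.le_succ n)
  have h1 : truncPow 0 (n + 1) = 1 := by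
    simp [truncPow, Ring.choose_zero_ite]
  rw [h1] at h
  rw [← neg_sub]
  simpa using (augIdeal ^ n).neg_mem h

theorem ratPow_add (α β : ℚ) : ratPow (α + β) = ratPow α * ratPow β := by
  ext n
  rw [AdicCompletion.val_mul, eq_comm]
  refine (Submodule.Quotient.eq _).2 ?_
  simpa using truncPow_add_mem α β n

section Module

variable (M : Type u) [AddCommGroup M] [DistribMulAction InfCyclic M]

/-- The action of `C` on `M` by automorphisms. -/
def intAction : InfCyclic →* MulAut (Multiplicative M) where
  toFun c := AddEquiv.toMultiplicative (DistribMulAction.toAddEquiv M c)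
  map_one' := by
    ext x
    change Multiplicative.ofAdd ((1 : InfCyclic) • x.toAdd) = x
    rw [one_smul, ofAdd_toAdd]
  map_mul' a b := by
    ext x
    change Multiplicative.ofAdd ((a * b) • x.toAdd) = Multiplicative.ofAdd (a • b • x.toAdd)
    rw [mul_smul]

/-- The group `G = M ⋊ C` for a `C`-module `M`. -/
abbrev MetabelianOverC : Type u :=
  Multiplicative M ⋊[intAction M] InfCyclic

/-- The representation of `C` on `M ⊗ ℚ`, written as `ℚ ⊗ M`. -/
def ratRep : Representation ℚ InfCyclic (ℚ ⊗[ℤ] M) where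
  toFun c := ((Representation.ofDistribMulAction ℤ InfCyclic M) c).baseChange ℚ
  map_one' := by ext; simp
  map_mul' x y := by ext; simp

/-- The `ℚ[C]`-module `M ⊗ ℚ`. -/
abbrev RatModule : Type u := (ratRep M).asModule

/-- The `I`-adic completion `(M ⊗ ℚ)^_I`. -/
abbrev RatModuleCompletion : Type u := AdicCompletion augIdeal (RatModule M)

/-- The canonical map `M → M ⊗ ℚ → (M ⊗ ℚ)^_I`. -/
def toRatModuleCompletion (m : M) : RatModuleCompletion M :=
  AdicCompletion.of augIdeal (RatModule M) ((ratRep M).asModuleEquiv.symm ((1 : ℚ) ⊗ₜ[ℤ] m))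

/-- The action of the group `ℚ = {t ^ α}` on `(M ⊗ ℚ)^_I` by
`t ^ α • x = ∑ (α choose k) (t - 1) ^ k • x`. -/
def ratAction : Multiplicative ℚ →* MulAut (Multiplicative (RatModuleCompletion M)) where
  toFun α := AddEquiv.toMultiplicative
    { toFun := fun x => ratPow α.toAdd • x
      invFun := fun x => ratPow (-α.toAdd) • x
      left_inv := fun x => by
        change ratPow (-α.toAdd) • ratPow α.toAdd • x = x
        rw [smul_smul, ← ratPow_add, neg_add_cancel, ratPow_zero, one_smul]
      right_inv := fun x => by
        change ratPow α.toAdd • ratPow (-α.toAdd) • x = x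
        rw [smul_smul, ← ratPow_add, add_neg_cancel, ratPow_zero, one_smul]
      map_add' := fun x y => smul_add _ x y }
  map_one' := by
    refine MulEquiv.ext fun x => ?_
    change Multiplicative.ofAdd (ratPow 0 • x.toAdd) = x
    rw [ratPow_zero, one_smul, ofAdd_toAdd]
  map_mul' α β := by
    refine MulEquiv.ext fun x => ?_
    change Multiplicative.ofAdd (ratPow (α.toAdd + β.toAdd) • x.toAdd) =
      Multiplicative.ofAdd (ratPow α.toAdd • ratPow β.toAdd • x.toAdd)
    rw [ratPow_add, mul_smul]

/-- The group `(M ⊗ ℚ)^_I ⋊ ℚ`. -/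
abbrev RatSemidirect : Type u :=
  Multiplicative (RatModuleCompletion M) ⋊[ratAction M] Multiplicative ℚ

end Module

end

/-! Write `V = M ⊗ ℚ` and `G = M ⋊ C`. The commutator of `m ∈ M` with `t` is `m` multiplied by `±(t
- 1)`, and `t - 1` generates `I`. Hence, up to torsion and roots, the lower rational central series
follows the `I`-adic filtration of `V`: by induction its term of index `i + 1` is the kernel of `G →
(V / I ^ (i + 1) V) ⋊ ℚ` (`mem_rationalLCS_metabelian`). The target is uniquely divisible, because
the equation for an `n`-th root is linear with a coefficient congruent to `n` modulo `I`, and such a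
coefficient is invertible modulo a power of `I`. So the map extends to the Malcev completion of the
quotient of `G`. The extension is injective by induction along central extensions
(`malcevToTrunc_injective`) and surjective because its image is closed under roots.

Since `V` is finite dimensional, `I ^ i V` is constant from some stage `N` on. Both the
`ℚ`-completion and `V^_I ⋊ ℚ` then equal `(V / I ^ N V) ⋊ ℚ`, which gives the isomorphism.

For homology, the map to this group factors as `G → V ⋊ C → (V / I ^ N V) ⋊ C → (V / I ^ N V) ⋊ ℚ`.
The middle map splits, because `I ^ N V` has a complement by Fitting's decomposition for `t - 1`.
The outer two are treated locally: a homology class involves finitely many group elements, and on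
suitable subgroups containing them each map restricts to an injection with image of finite index.
Such an injection is surjective on rational homology by transfer (`subtype_of_finiteIndex`), which
is built by hand on bar chains. -/

noncomputable section

/-! ### Homogeneous chains -/

namespace HomogeneousChain

variable {L L' : Type*}

/-- The simplicial boundary on homogeneous chains; `Fin n → L` indexes simplices of dimension
`n - 1`, so that the complex is augmented. -/
def boundary (L : Type*) (n : ℕ) : ((Fin (n + 1) → L) →₀ ℚ) →ₗ[ℚ] ((Fin n → L) →₀ ℚ) :=
  Finsupp.linearCombination ℚ fun x =>
    ∑ i : Fin (n + 1), (-1 : ℚ) ^ (i : ℕ) • Finsupp.single (x ∘ i.succAbove) 1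

theorem boundary_single (n : ℕ) (x : Fin (n + 1) → L) :
    boundary L n (Finsupp.single x 1) =
      ∑ i : Fin (n + 1), (-1 : ℚ) ^ (i : ℕ) • Finsupp.single (x ∘ i.succAbove) 1 := by
  simp [boundary]

/-- The map on chains induced by a map of vertices. -/
def push (f : L → L') (n : ℕ) : ((Fin n → L) →₀ ℚ) →ₗ[ℚ] ((Fin n → L') →₀ ℚ) :=
  Finsupp.lmapDomain ℚ ℚ (f ∘ ·)

theorem push_single (f : L → L') (n : ℕ) (x : Fin n → L) (a : ℚ) :
    push f n (Finsupp.single x a) = Finsupp.single (f ∘ x) a := by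
  simp [push]

theorem boundary_push (f : L → L') (n : ℕ) (y : (Fin (n + 1) → L) →₀ ℚ) :
    boundary L' n (push f (n + 1) y) = push f n (boundary L n y) := by
  suffices h : boundary L' n ∘ₗ push f (n + 1) = push f n ∘ₗ boundary L n from
    LinearMap.congr_fun h y
  ext x : 3
  simp [push_single, boundary_single, map_sum, Function.comp_assoc]

/-- The cone with a given apex. -/
def cone (g : L) (n : ℕ) : ((Fin n → L) →₀ ℚ) →ₗ[ℚ] ((Fin (n + 1) → L) →₀ ℚ) :=
  Finsupp.lmapDomain ℚ ℚ fun x => (Fin.cons g x : Fin (n + 1) → L)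

theorem cone_single (g : L) (n : ℕ) (x : Fin n → L) (a : ℚ) :
    cone g n (Finsupp.single x a) = Finsupp.single (Fin.cons g x : Fin (n + 1) → L) a := by
  simp [cone]

theorem push_cone (f : L → L') (g : L) (n : ℕ) (y : (Fin n → L) →₀ ℚ) :
    push f (n + 1) (cone g n y) = cone (f g) n (push f n y) := by
  suffices h : push f (n + 1) ∘ₗ cone g n = cone (f g) n ∘ₗ push f n from
    LinearMap.congr_fun h y
  ext x : 3
  simp [push_single, cone_single, Fin.comp_cons]

theorem boundary_cone_zero (g : L) (y : (Fin 0 → L) →₀ ℚ) : boundary L 0 (cone g 0 y) = y := by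
  suffices h : boundary L 0 ∘ₗ cone g 0 = LinearMap.id from LinearMap.congr_fun h y
  ext x : 3
  simp [cone_single, boundary_single, Subsingleton.elim _ x]

/-- Deleting the apex returns the chain; deleting a later vertex gives the cone on a face, with the
sign shifted by one. -/
theorem boundary_cone (g : L) (n : ℕ) (y : (Fin (n + 1) → L) →₀ ℚ) :
    boundary L (n + 1) (cone g (n + 1) y) = y - cone g n (boundary L n y) := by
  suffices h : boundary L (n + 1) ∘ₗ cone g (n + 1) = LinearMap.id - cone g n ∘ₗ boundary L n from
    LinearMap.congr_fun h y
  ext x : 3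
  have h0 : (Fin.cons g x : Fin (n + 2) → L) ∘ Fin.succ = x := funext fun i => by simp
  have h1 (i : Fin (n + 1)) : (Fin.cons g x : Fin (n + 2) → L) ∘ i.succ.succAbove =
      Fin.cons g (x ∘ i.succAbove) := by
    ext j
    refine Fin.cases ?_ (fun j => ?_) j <;> simp
  simp only [LinearMap.comp_apply, Finsupp.lsingle_apply, cone_single, boundary_single,
    LinearMap.sub_apply, LinearMap.id_apply, map_sum, map_smul]
  rw [Fin.sum_univ_succ]
  simp [h0, h1, pow_succ, sub_eq_add_neg, Finset.sum_neg_distrib]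

/-- Every simplex is the cone on its tail, so the cone formula lowers the dimension by one. -/
theorem boundary_boundary (n : ℕ) (y : (Fin (n + 2) → L) →₀ ℚ) :
    boundary L n (boundary L (n + 1) y) = 0 := by
  induction n with
  | zero =>
    induction y using Finsupp.induction_linear with
    | zero => simp
    | add f g hf hg => simp [hf, hg]
    | single x a =>
      have h : Finsupp.single x a = cone (x 0) 1 (Finsupp.single (Fin.tail x) a) := by
        rw [cone_single, Fin.cons_self_tail]
      rw [h, boundary_cone, map_sub, boundary_cone_zero, sub_self]
  | succ n ih =>
    induction y using Finsupp.induction_linear with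
    | zero => simp
    | add f g hf hg => simp [hf, hg]
    | single x a =>
      have h : Finsupp.single x a = cone (x 0) (n + 2) (Finsupp.single (Fin.tail x) a) := by
        rw [cone_single, Fin.cons_self_tail]
      rw [h, boundary_cone, map_sub, boundary_cone, ih, map_zero, sub_zero, sub_self]

/-- The homotopy between the identity and the chain map induced by a self-map of the vertices. -/
def homotopy (ρ : L → L) : ∀ n : ℕ, ((Fin n → L) →₀ ℚ) →ₗ[ℚ] ((Fin (n + 1) → L) →₀ ℚ)
  | 0 => 0
  | n + 1 => Finsupp.linearCombination ℚ fun x =>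
      cone (x 0) (n + 1) (push ρ (n + 1) (Finsupp.single x 1) - Finsupp.single x 1 -
        homotopy ρ n (boundary L n (Finsupp.single x 1)))

theorem homotopy_succ_single (ρ : L → L) (n : ℕ) (x : Fin (n + 1) → L) :
    homotopy ρ (n + 1) (Finsupp.single x 1) =
      cone (x 0) (n + 1) (push ρ (n + 1) (Finsupp.single x 1) - Finsupp.single x 1 -
        homotopy ρ n (boundary L n (Finsupp.single x 1))) := by
  simp [homotopy]

/-- The chain that is coned off in `homotopy` is a cycle, by the formula one dimension lower and
`boundary_boundary`; hence the boundary of its cone is the chain itself. -/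
theorem boundary_homotopy (ρ : L → L) (n : ℕ) (y : (Fin (n + 1) → L) →₀ ℚ) :
    boundary L (n + 1) (homotopy ρ (n + 1) y) =
      push ρ (n + 1) y - y - homotopy ρ n (boundary L n y) := by
  induction n with
  | zero =>
    suffices h : boundary L 1 ∘ₗ homotopy ρ 1 =
        push ρ 1 - LinearMap.id - homotopy ρ 0 ∘ₗ boundary L 0 from LinearMap.congr_fun h y
    ext x : 3
    simp only [LinearMap.comp_apply, Finsupp.lsingle_apply, homotopy_succ_single, boundary_cone,
      LinearMap.sub_apply, LinearMap.id_apply]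
    have h (z : (Fin 0 → L) →₀ ℚ) : push ρ 0 z = z := by
      suffices h : push ρ 0 = LinearMap.id from LinearMap.congr_fun h z
      ext x : 3
      simp [push_single, Subsingleton.elim _ x]
    simp [map_sub, boundary_push, h, homotopy]
  | succ n ih =>
    suffices h : boundary L (n + 2) ∘ₗ homotopy ρ (n + 2) =
        push ρ (n + 2) - LinearMap.id - homotopy ρ (n + 1) ∘ₗ boundary L (n + 1) from
      LinearMap.congr_fun h y
    ext x : 3
    simp only [LinearMap.comp_apply, Finsupp.lsingle_apply, homotopy_succ_single, boundary_cone,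
      LinearMap.sub_apply, LinearMap.id_apply]
    simp [map_sub, boundary_push, ih, boundary_boundary]

/-- The apex is the first vertex of the simplex rather than a fixed point, so the construction is
natural. It is applied to translations by elements of a subgroup. -/
theorem push_homotopy (ρ : L → L) (g : L → L) (hg : ∀ x, ρ (g x) = g (ρ x)) (n : ℕ)
    (y : (Fin n → L) →₀ ℚ) : push g (n + 1) (homotopy ρ n y) = homotopy ρ n (push g n y) := by
  induction n with
  | zero => simp [homotopy]
  | succ n ih =>
    suffices h : push g (n + 2) ∘ₗ homotopy ρ (n + 1) = homotopy ρ (n + 1) ∘ₗ push g (n + 1) from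
      LinearMap.congr_fun h y
    ext x : 3
    have hc : ρ ∘ g ∘ x = g ∘ ρ ∘ x := funext fun i => hg _
    simp only [LinearMap.comp_apply, Finsupp.lsingle_apply, homotopy_succ_single, push_cone,
      push_single, map_sub, ih, ← boundary_push, hc, Function.comp_apply]

end HomogeneousChain

/-! ### Inhomogeneous chains with rational coefficients -/

namespace InhomogeneousChain

open HomogeneousChain

variable {L K : Type*} [Group L] [Group K]

/-- The bar differential with trivial rational coefficients. -/
def diff (L : Type*) [Group L] (n : ℕ) :
    ((Fin (n + 1) → L) →₀ ℚ) →ₗ[ℚ] ((Fin n → L) →₀ ℚ) :=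
  Finsupp.linearCombination ℚ fun g => Finsupp.single (Fin.tail g) 1 +
    ∑ j : Fin (n + 1), (-1 : ℚ) ^ ((j : ℕ) + 1) •
      Finsupp.single (Fin.contractNth j (· * ·) g) 1

theorem diff_single (n : ℕ) (g : Fin (n + 1) → L) :
    diff L n (Finsupp.single g 1) = Finsupp.single (Fin.tail g) 1 +
      ∑ j : Fin (n + 1), (-1 : ℚ) ^ ((j : ℕ) + 1) •
        Finsupp.single (Fin.contractNth j (· * ·) g) 1 := by
  simp [diff]

/-- The homogeneous chain with first vertex `1` attached to an inhomogeneous chain. -/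
def toHomogeneous (L : Type*) [Group L] (n : ℕ) :
    ((Fin n → L) →₀ ℚ) →ₗ[ℚ] ((Fin (n + 1) → L) →₀ ℚ) :=
  Finsupp.lmapDomain ℚ ℚ Fin.partialProd

/-- The projection from homogeneous chains to inhomogeneous chains. -/
def ofHomogeneous (L : Type*) [Group L] (n : ℕ) :
    ((Fin (n + 1) → L) →₀ ℚ) →ₗ[ℚ] ((Fin n → L) →₀ ℚ) :=
  Finsupp.lmapDomain ℚ ℚ fun x i => (x i.castSucc)⁻¹ * x i.succ

theorem toHomogeneous_single (n : ℕ) (g : Fin n → L) (a : ℚ) :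
    toHomogeneous L n (Finsupp.single g a) = Finsupp.single (Fin.partialProd g) a := by
  simp [toHomogeneous]

theorem ofHomogeneous_single (n : ℕ) (x : Fin (n + 1) → L) (a : ℚ) :
    ofHomogeneous L n (Finsupp.single x a) =
      Finsupp.single (fun i => (x i.castSucc)⁻¹ * x i.succ) a := by
  simp [ofHomogeneous]

theorem ofHomogeneous_toHomogeneous (n : ℕ) (y : (Fin n → L) →₀ ℚ) :
    ofHomogeneous L n (toHomogeneous L n y) = y := by
  suffices h : ofHomogeneous L n ∘ₗ toHomogeneous L n = LinearMap.id from LinearMap.congr_fun h y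
  ext x : 3
  simp only [LinearMap.comp_apply, Finsupp.lsingle_apply, toHomogeneous_single,
    ofHomogeneous_single, Fin.partialProd_right_inv, LinearMap.id_apply]

theorem ofHomogeneous_translate (g : L) (n : ℕ) (y : (Fin (n + 1) → L) →₀ ℚ) :
    ofHomogeneous L n (push (g * ·) (n + 1) y) = ofHomogeneous L n y := by
  suffices h : ofHomogeneous L n ∘ₗ push (g * ·) (n + 1) = ofHomogeneous L n from
    LinearMap.congr_fun h y
  ext x : 3
  simp [push_single, ofHomogeneous_single, mul_assoc]

theorem ofHomogeneous_push (f : K →* L) (n : ℕ) (y : (Fin (n + 1) → K) →₀ ℚ) :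
    ofHomogeneous L n (push f (n + 1) y) = push f n (ofHomogeneous K n y) := by
  suffices h : ofHomogeneous L n ∘ₗ push f (n + 1) = push f n ∘ₗ ofHomogeneous K n from
    LinearMap.congr_fun h y
  ext x : 3
  simp only [LinearMap.comp_apply, Finsupp.lsingle_apply, push_single, ofHomogeneous_single]
  have h : (fun i : Fin n => ((f ∘ x) i.castSucc)⁻¹ * (f ∘ x) i.succ) =
      f ∘ fun i : Fin n => (x i.castSucc)⁻¹ * x i.succ := funext fun i => by simp
  rw [h]

/-- Only the face omitting the initial vertex `1` has to be translated back to start at `1`; it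
accounts for the exceptional first term of the bar differential. -/
theorem boundary_toHomogeneous_single (n : ℕ) (g : Fin (n + 1) → L) :
    boundary L (n + 1) (toHomogeneous L (n + 1) (Finsupp.single g 1)) =
      push (g 0 * ·) (n + 1) (toHomogeneous L n (Finsupp.single (Fin.tail g) 1)) +
      ∑ j : Fin (n + 1), (-1 : ℚ) ^ ((j : ℕ) + 1) •
        toHomogeneous L n (Finsupp.single (Fin.contractNth j (· * ·) g) 1) := by
  rw [toHomogeneous_single, boundary_single, Fin.sum_univ_succ]
  simp only [toHomogeneous_single, push_single, Fin.partialProd_contractNth, Fin.val_zero,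
    pow_zero, one_smul, Fin.val_succ]
  congr 2
  ext i
  simp [Fin.partialProd_succ']

theorem single_eq_push_toHomogeneous (n : ℕ) (x : Fin (n + 1) → L) :
    Finsupp.single x (1 : ℚ) = push (x 0 * ·) (n + 1) (toHomogeneous L n
      (Finsupp.single (fun i => (x i.castSucc)⁻¹ * x i.succ) 1)) := by
  rw [toHomogeneous_single, push_single]
  congr 1
  ext i
  refine Fin.induction ?_ (fun i ih => ?_) i
  · simp
  · simp only [Function.comp_apply] at ih ⊢
    rw [Fin.partialProd_succ, ← mul_assoc, ← ih, mul_inv_cancel_left]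

/-- By translation invariance a simplex may be assumed to start at `1`. -/
theorem ofHomogeneous_boundary (n : ℕ) (y : (Fin (n + 2) → L) →₀ ℚ) :
    ofHomogeneous L n (boundary L (n + 1) y) = diff L n (ofHomogeneous L (n + 1) y) := by
  suffices h : ofHomogeneous L n ∘ₗ boundary L (n + 1) = diff L n ∘ₗ ofHomogeneous L (n + 1) from
    LinearMap.congr_fun h y
  ext x : 3
  simp only [LinearMap.comp_apply, Finsupp.lsingle_apply]
  rw [single_eq_push_toHomogeneous (n + 1) x, boundary_push, ofHomogeneous_translate,
    ofHomogeneous_translate, ofHomogeneous_toHomogeneous, boundary_toHomogeneous_single, map_add,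
    ofHomogeneous_translate, diff_single, map_sum, ofHomogeneous_toHomogeneous]
  simp [ofHomogeneous_toHomogeneous]

/-- A translation invariant linear map turns the homogeneous boundary into the bar
differential. -/
theorem map_boundary_toHomogeneous {W : Type*} [AddCommGroup W] [Module ℚ W] (n : ℕ)
    (F : ((Fin (n + 1) → L) →₀ ℚ) →ₗ[ℚ] W)
    (hF : ∀ (g : L) y, F (push (g * ·) (n + 1) y) = F y) (z : (Fin (n + 1) → L) →₀ ℚ) :
    F (boundary L (n + 1) (toHomogeneous L (n + 1) z)) = F (toHomogeneous L n (diff L n z)) := by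
  suffices h : F ∘ₗ boundary L (n + 1) ∘ₗ toHomogeneous L (n + 1) =
      F ∘ₗ toHomogeneous L n ∘ₗ diff L n from LinearMap.congr_fun h z
  ext x : 3
  simp only [LinearMap.comp_apply, Finsupp.lsingle_apply, boundary_toHomogeneous_single, map_add,
    hF, diff_single, map_sum, map_smul]

end InhomogeneousChain

/-! ### Transfer for subgroups of finite index -/

namespace InhomogeneousChain

open HomogeneousChain

variable {L : Type*} [Group L] (K : Subgroup L)

/-- The retraction of `L` onto `K` given by a transversal. -/
def cosetRetraction (x : L) : K :=
  -- The representative is taken in the left coset of `x⁻¹`, which does not change when `x` is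
  -- multiplied on the left by an element of `K`; this gives equivariance.
  ⟨x * (QuotientGroup.mk x⁻¹ : L ⧸ K).out, by
    have h := QuotientGroup.mk_out_eq_mul K x⁻¹
    obtain ⟨k, hk⟩ := h
    rw [hk, mul_inv_cancel_left]
    exact k.2⟩

theorem cosetRetraction_mul (k : K) (x : L) :
    cosetRetraction K (k * x) = k * cosetRetraction K x := by
  have h : (QuotientGroup.mk (k * x : L)⁻¹ : L ⧸ K) = QuotientGroup.mk x⁻¹ := by
    rw [QuotientGroup.eq]
    simp
  apply Subtype.ext
  simp only [cosetRetraction, h, Subgroup.coe_mul, mul_assoc]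

variable [Fintype (L ⧸ K)] {W : Type*} [AddCommGroup W] [Module ℚ W]

/-- The sum over a transversal of the translates of a linear map on chains. -/
def transversalSum {n : ℕ} (φ : ((Fin n → L) →₀ ℚ) →ₗ[ℚ] W) : ((Fin n → L) →₀ ℚ) →ₗ[ℚ] W :=
  ∑ q : L ⧸ K, φ ∘ₗ push (q.out⁻¹ * ·) n

theorem transversalSum_apply {n : ℕ} (φ : ((Fin n → L) →₀ ℚ) →ₗ[ℚ] W) (y : (Fin n → L) →₀ ℚ) :
    transversalSum K φ y = ∑ q : L ⧸ K, φ (push (q.out⁻¹ * ·) n y) := by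
  simp [transversalSum]

/-- Invariance of `φ` under `K` makes each summand depend only on the coset, so translation by `g`
permutes the summands. -/
theorem transversalSum_translate {n : ℕ} (φ : ((Fin n → L) →₀ ℚ) →ₗ[ℚ] W)
    (hφ : ∀ (k : K) y, φ (push ((k : L) * ·) n y) = φ y) (g : L) (y : (Fin n → L) →₀ ℚ) :
    transversalSum K φ (push (g * ·) n y) = transversalSum K φ y := by
  suffices h : transversalSum K φ ∘ₗ push (g * ·) n = transversalSum K φ from
    LinearMap.congr_fun h y
  ext x : 3
  simp only [LinearMap.comp_apply, Finsupp.lsingle_apply, transversalSum_apply, push_single]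
  have hinv (a b : L) (hab : a⁻¹ * b ∈ K) :
      φ (Finsupp.single ((a⁻¹ * ·) ∘ x) 1) = φ (Finsupp.single ((b⁻¹ * ·) ∘ x) 1) := by
    rw [← hφ ⟨a⁻¹ * b, hab⟩ (Finsupp.single ((b⁻¹ * ·) ∘ x) 1), push_single]
    congr 2
    funext i
    simp [mul_assoc]
  let ψ : L ⧸ K → W := Quotient.lift (fun a : L => φ (Finsupp.single ((a⁻¹ * ·) ∘ x) 1))
    fun a b h => hinv a b (QuotientGroup.leftRel_apply.mp h)
  have hψ (a : L) : ψ (QuotientGroup.mk a) = φ (Finsupp.single ((a⁻¹ * ·) ∘ x) 1) := rfl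
  calc _ = ∑ q : L ⧸ K, ψ (g⁻¹ • q) := by
        refine Finset.sum_congr rfl fun q _ => ?_
        conv_rhs => rw [← QuotientGroup.out_eq' q]
        change _ = ψ (QuotientGroup.mk (g⁻¹ * q.out))
        rw [hψ]
        congr 2
        funext i
        simp [mul_assoc]
    _ = ∑ q : L ⧸ K, ψ q := Equiv.sum_comp (MulAction.toPerm g⁻¹) ψ
    _ = _ := by
        refine Finset.sum_congr rfl fun q _ => ?_
        conv_lhs => rw [← QuotientGroup.out_eq' q]
        exact hψ _

/-- The transfer on inhomogeneous chains. -/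
def transfer (n : ℕ) : ((Fin n → L) →₀ ℚ) →ₗ[ℚ] ((Fin n → K) →₀ ℚ) :=
  transversalSum K (ofHomogeneous K n ∘ₗ push (cosetRetraction K) (n + 1)) ∘ₗ toHomogeneous L n

/-- The homotopy between the composite of transfer and inclusion and multiplication by the
index. -/
def transferHomotopy (n : ℕ) : ((Fin n → L) →₀ ℚ) →ₗ[ℚ] ((Fin (n + 1) → L) →₀ ℚ) :=
  transversalSum K (ofHomogeneous L (n + 1) ∘ₗ
    homotopy (fun x => (cosetRetraction K x : L)) (n + 1)) ∘ₗ toHomogeneous L n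

theorem push_push {A B C : Type*} (f : A → B) (g : B → C) (n : ℕ) (y : (Fin n → A) →₀ ℚ) :
    push g n (push f n y) = push (g ∘ f) n y := by
  suffices h : push g n ∘ₗ push f n = push (g ∘ f) n from LinearMap.congr_fun h y
  ext x : 3
  simp [push_single, Function.comp_assoc]

theorem diff_transfer (n : ℕ) (z : (Fin (n + 1) → L) →₀ ℚ) :
    diff K n (transfer K (n + 1) z) = transfer K n (diff L n z) := by
  have hφ (k : K) (y : (Fin (n + 1) → L) →₀ ℚ) :
      (ofHomogeneous K n ∘ₗ push (cosetRetraction K) (n + 1)) (push ((k : L) * ·) (n + 1) y) =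
        (ofHomogeneous K n ∘ₗ push (cosetRetraction K) (n + 1)) y := by
    have h : cosetRetraction K ∘ ((k : L) * ·) = (k * ·) ∘ cosetRetraction K :=
      funext fun x => cosetRetraction_mul K k x
    simp only [LinearMap.comp_apply]
    rw [push_push, h, ← push_push, ofHomogeneous_translate]
  rw [transfer, transfer, LinearMap.comp_apply, LinearMap.comp_apply,
    ← map_boundary_toHomogeneous n _ (transversalSum_translate K _ hφ)]
  simp only [transversalSum_apply, LinearMap.comp_apply, map_sum, ← ofHomogeneous_boundary,
    boundary_push]

theorem ofHomogeneous_sum_push (n : ℕ) (z : (Fin n → L) →₀ ℚ) :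
    ∑ q : L ⧸ K, ofHomogeneous L n (push (fun x => (cosetRetraction K x : L)) (n + 1)
        (push (q.out⁻¹ * ·) (n + 1) (toHomogeneous L n z))) =
      push K.subtype n (transfer K n z) := by
  simp only [transfer, transversalSum_apply, LinearMap.comp_apply, map_sum, ← ofHomogeneous_push,
    push_push]
  rfl

theorem diff_transferHomotopy_zero (z : (Fin 0 → L) →₀ ℚ) :
    diff L 0 (transferHomotopy K 0 z) =
      push K.subtype 0 (transfer K 0 z) - (Fintype.card (L ⧸ K) : ℚ) • z := by
  simp only [transferHomotopy, transversalSum_apply, LinearMap.comp_apply, map_sum,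
    ← ofHomogeneous_boundary, boundary_homotopy, map_sub, Finset.sum_sub_distrib,
    ofHomogeneous_sum_push, ofHomogeneous_translate, ofHomogeneous_toHomogeneous]
  simp [homotopy]
  module

/-- This is `boundary_homotopy` summed over the transversal. All translates of a chain have the same
inhomogeneous image, so the identity terms add up to the index; the retraction terms add up to
transfer followed by inclusion. -/
theorem diff_transferHomotopy_succ (n : ℕ) (z : (Fin (n + 1) → L) →₀ ℚ) :
    diff L (n + 1) (transferHomotopy K (n + 1) z) =
      push K.subtype (n + 1) (transfer K (n + 1) z) - (Fintype.card (L ⧸ K) : ℚ) • z -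
        transferHomotopy K n (diff L n z) := by
  have hφ (k : K) (y : (Fin (n + 1) → L) →₀ ℚ) :
      (ofHomogeneous L (n + 1) ∘ₗ homotopy (fun x => (cosetRetraction K x : L)) (n + 1))
        (push ((k : L) * ·) (n + 1) y) =
      (ofHomogeneous L (n + 1) ∘ₗ homotopy (fun x => (cosetRetraction K x : L)) (n + 1)) y := by
    have h (x : L) : (cosetRetraction K (k * x) : L) = k * cosetRetraction K x := by
      rw [cosetRetraction_mul, Subgroup.coe_mul]
    simp only [LinearMap.comp_apply]
    rw [← push_homotopy _ _ h, ofHomogeneous_translate]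
  have key : transferHomotopy K n (diff L n z) = ∑ q : L ⧸ K, ofHomogeneous L (n + 1)
      (homotopy (fun x => (cosetRetraction K x : L)) (n + 1) (boundary L (n + 1)
        (push (q.out⁻¹ * ·) (n + 2) (toHomogeneous L (n + 1) z)))) := by
    rw [transferHomotopy, LinearMap.comp_apply,
      ← map_boundary_toHomogeneous n _ (transversalSum_translate K _ hφ)]
    simp only [transversalSum_apply, LinearMap.comp_apply, boundary_push]
  rw [key]
  simp only [transferHomotopy, transversalSum_apply, LinearMap.comp_apply, map_sum,
    ← ofHomogeneous_boundary, boundary_homotopy, map_sub, Finset.sum_sub_distrib,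
    ofHomogeneous_sum_push, ofHomogeneous_translate, ofHomogeneous_toHomogeneous]
  simp [Nat.cast_smul_eq_nsmul]

end InhomogeneousChain

/-! ### Homomorphisms that are surjective on rational homology -/

/-- A homomorphism inducing surjections on all rational homology groups. -/
def RationalHomologySurjective {G H : Type} [Group G] [Group H] (f : G →* H) : Prop :=
  ∀ n : ℕ, Function.Surjective (rationalHomologyMap f n)

namespace RationalHomologySurjective

open HomogeneousChain InhomogeneousChain CategoryTheory

variable {G H K : Type} [Group G] [Group H] [Group K]

/-- The identity of `ℚ` as a morphism from the trivial representation of `G` to the restriction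
of the trivial representation of `H`. -/
def trivialHom (f : G →* H) : Rep.trivial ℚ G ℚ ⟶ Rep.res f (Rep.trivial ℚ H ℚ) :=
  𝟙 (Rep.trivial ℚ G ℚ)

theorem rationalHomologyMap_eq (f : G →* H) (n : ℕ) :
    rationalHomologyMap f n = groupHomology.map f (trivialHom f) n := rfl

theorem rationalHomologyMap_comp (f : G →* H) (g : H →* K) (n : ℕ) :
    rationalHomologyMap (g.comp f) n = rationalHomologyMap f n ≫ rationalHomologyMap g n := by
  simp only [rationalHomologyMap_eq]
  rw [← groupHomology.map_comp]
  rfl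

theorem rationalHomologyMap_comp_apply (f : G →* H) (g : H →* K) (n : ℕ)
    (x : groupHomology (Rep.trivial ℚ G ℚ) n) :
    rationalHomologyMap (g.comp f) n x = rationalHomologyMap g n (rationalHomologyMap f n x) := by
  rw [rationalHomologyMap_comp]
  rfl

theorem rationalHomologyMap_id (n : ℕ) :
    rationalHomologyMap (MonoidHom.id G) n = 𝟙 _ :=
  groupHomology.map_id n

theorem comp {g : H →* K} {f : G →* H} (hg : RationalHomologySurjective g)
    (hf : RationalHomologySurjective f) : RationalHomologySurjective (g.comp f) := by
  intro n
  rw [rationalHomologyMap_comp]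
  exact (hg n).comp (hf n)

theorem of_comp {g : H →* K} {f : G →* H} (h : RationalHomologySurjective (g.comp f)) :
    RationalHomologySurjective g := by
  intro n z
  obtain ⟨x, hx⟩ := h n z
  rw [rationalHomologyMap_comp] at hx
  exact ⟨_, hx⟩

theorem of_rightInverse {g : H →* K} (s : K →* H) (h : g.comp s = MonoidHom.id K) :
    RationalHomologySurjective g := by
  refine of_comp (f := s) ?_
  intro n
  rw [h, rationalHomologyMap_id]
  exact Function.surjective_id

theorem chains_d_apply (n : ℕ) (z : (Fin (n + 1) → G) →₀ ℚ) :
    (groupHomology.inhomogeneousChains (Rep.trivial ℚ G ℚ)).d (n + 1) n z = diff G n z := by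
  rw [groupHomology.inhomogeneousChains.d_def]
  suffices h : (groupHomology.inhomogeneousChains.d (Rep.trivial ℚ G ℚ) n).hom = diff G n from
    LinearMap.congr_fun h z
  refine Finsupp.lhom_ext' fun x => LinearMap.ext_ring ?_
  change groupHomology.inhomogeneousChains.d (Rep.trivial ℚ G ℚ) n (Finsupp.single x (1 : ℚ)) =
    diff G n (Finsupp.single x 1)
  rw [groupHomology.inhomogeneousChains.d_single, diff_single]
  rfl

theorem chainsMap_apply (f : G →* H) (n : ℕ) (z : (Fin n → G) →₀ ℚ) :
    (groupHomology.chainsMap f (trivialHom f)).f n z = push f n z := by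
  suffices h : ((groupHomology.chainsMap f (trivialHom f)).f n).hom = push f n from
    LinearMap.congr_fun h z
  refine Finsupp.lhom_ext' fun x => LinearMap.ext_ring ?_
  change (groupHomology.chainsMap f (trivialHom f)).f n (Finsupp.single x (1 : ℚ)) =
    push f n (Finsupp.single x 1)
  rw [push_single]
  exact groupHomology.chainsMap_f_single _ _ _ _ _

/-- The cycles among the inhomogeneous chains. -/
def IsCycle : ∀ {n : ℕ}, ((Fin n → G) →₀ ℚ) → Prop
  | 0, _ => True
  | n + 1, z => diff G n z = 0

theorem isCycle_iff {n : ℕ} (z : (Fin n → G) →₀ ℚ) :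
    IsCycle z ↔ (groupHomology.inhomogeneousChains (Rep.trivial ℚ G ℚ)).d n
      ((ComplexShape.down ℕ).next n) z = 0 := by
  cases n with
  | zero =>
    -- Degree `0` has no successor in the shape, so `next 0` takes the default value `0` and the
    -- differential vanishes.
    have h : (groupHomology.inhomogeneousChains (Rep.trivial ℚ G ℚ)).d 0
        ((ComplexShape.down ℕ).next 0) = 0 := by
      apply HomologicalComplex.shape
      simp
    rw [h]
    simp [IsCycle]
  | succ n =>
    rw [ChainComplex.next_nat_succ, chains_d_apply]
    rfl

/-- The homology class of a cycle. -/
def homologyClass {n : ℕ} (z : (Fin n → G) →₀ ℚ) (hz : IsCycle z) :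
    groupHomology (Rep.trivial ℚ G ℚ) n :=
  groupHomology.π (Rep.trivial ℚ G ℚ) n
    (groupHomology.cyclesMk n _ rfl z ((isCycle_iff z).1 hz))

theorem exists_homologyClass {n : ℕ} (x : groupHomology (Rep.trivial ℚ G ℚ) n) :
    ∃ z, ∃ hz : IsCycle z, homologyClass z hz = x := by
  induction x using groupHomology_induction_on with
  | h x =>
    have h1 : IsCycle (groupHomology.iCycles (Rep.trivial ℚ G ℚ) n x :
        (Fin n → G) →₀ ℚ) := by
      rw [isCycle_iff]
      exact ConcreteCategory.congr_hom ((groupHomology.inhomogeneousChains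
        (Rep.trivial ℚ G ℚ)).iCycles_d n ((ComplexShape.down ℕ).next n)) x
    refine ⟨_, h1, ?_⟩
    unfold homologyClass
    congr 1
    apply (ModuleCat.mono_iff_injective
      (groupHomology.iCycles (Rep.trivial ℚ G ℚ) n)).1 inferInstance
    rw [groupHomology.iCycles_mk]

theorem isCycle_push (f : G →* H) {n : ℕ} {z : (Fin n → G) →₀ ℚ} (hz : IsCycle z) :
    IsCycle (push f n z) := by
  rw [isCycle_iff] at hz ⊢
  rw [← chainsMap_apply]
  have h := ConcreteCategory.congr_hom ((groupHomology.chainsMap f (trivialHom f)).comm n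
          ((ComplexShape.down ℕ).next n)) z
  rw [ModuleCat.comp_apply, ModuleCat.comp_apply, hz, map_zero] at h
  exact h

theorem map_homologyClass (f : G →* H) {n : ℕ} (z : (Fin n → G) →₀ ℚ) (hz : IsCycle z) :
    rationalHomologyMap f n (homologyClass z hz) =
      homologyClass (push f n z) (isCycle_push f hz) := by
  unfold homologyClass
  rw [rationalHomologyMap_eq]
  rw [groupHomology.π_map_apply]
  congr 1
  apply (ModuleCat.mono_iff_injective
    (groupHomology.iCycles (Rep.trivial ℚ H ℚ) n)).1 inferInstance
  rw [groupHomology.iCycles_mk, ← chainsMap_apply]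
  have h := ConcreteCategory.congr_hom (HomologicalComplex.cyclesMap_i
    (groupHomology.chainsMap f (trivialHom f)) n)
    (groupHomology.cyclesMk n _ rfl z ((isCycle_iff z).1 hz))
  refine h.trans ?_
  rw [ModuleCat.comp_apply, groupHomology.iCycles_mk]

theorem homologyClass_eq {n : ℕ} {z w : (Fin n → G) →₀ ℚ} (hz : IsCycle z) (hw : IsCycle w)
    (b : (Fin (n + 1) → G) →₀ ℚ) (hb : diff G n b = w - z) :
    homologyClass w hw = homologyClass z hz := by
  rw [← sub_eq_zero]
  unfold homologyClass
  rw [← map_sub]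
  have h : groupHomology.cyclesMk n _ rfl w ((isCycle_iff w).1 hw) -
      groupHomology.cyclesMk n _ rfl z ((isCycle_iff z).1 hz) =
      groupHomology.toCycles (Rep.trivial ℚ G ℚ) (n + 1) n b := by
    apply (ModuleCat.mono_iff_injective
      (groupHomology.iCycles (Rep.trivial ℚ G ℚ) n)).1 inferInstance
    rw [map_sub, groupHomology.iCycles_mk, groupHomology.iCycles_mk, ← ModuleCat.comp_apply,
      HomologicalComplex.toCycles_i, chains_d_apply, hb]
  rw [h]
  exact ConcreteCategory.congr_hom ((groupHomology.inhomogeneousChains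
    (Rep.trivial ℚ G ℚ)).toCycles_comp_homologyπ (n + 1) n) b

/-- A criterion on the level of chains. -/
theorem of_chains {f : G →* H} (h : ∀ (n : ℕ) (z : (Fin n → H) →₀ ℚ), IsCycle z →
    ∃ w : (Fin n → G) →₀ ℚ, IsCycle w ∧ ∃ b, diff H n b = push f n w - z) :
    RationalHomologySurjective f := by
  intro n x
  obtain ⟨z, hz, rfl⟩ := exists_homologyClass x
  obtain ⟨w, hw, b, hb⟩ := h n z hz
  exact ⟨homologyClass w hw, (map_homologyClass f w hw).trans (homologyClass_eq hz _ b hb)⟩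

/-- A cycle is homologous to the image of its transfer divided by the index; the division requires
rational coefficients. -/
theorem subtype_of_finiteIndex (S : Subgroup G) [S.FiniteIndex] :
    RationalHomologySurjective S.subtype := by
  have : Fintype (G ⧸ S) := Fintype.ofFinite _
  have hc : (Fintype.card (G ⧸ S) : ℚ) ≠ 0 := Nat.cast_ne_zero.mpr Fintype.card_ne_zero
  refine of_chains fun n z hz => ⟨(Fintype.card (G ⧸ S) : ℚ)⁻¹ • transfer S n z, ?_,
    (Fintype.card (G ⧸ S) : ℚ)⁻¹ • transferHomotopy S n z, ?_⟩
  · cases n with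
    | zero => trivial
    | succ n =>
      have hz' : diff G n z = 0 := hz
      change diff S n _ = 0
      rw [map_smul, diff_transfer, hz', map_zero, smul_zero]
  · rw [map_smul, map_smul]
    cases n with
    | zero => rw [diff_transferHomotopy_zero, smul_sub, inv_smul_smul₀ hc]
    | succ n =>
      have hz' : diff G n z = 0 := hz
      rw [diff_transferHomotopy_succ, hz', map_zero, sub_zero, smul_sub, inv_smul_smul₀ hc]

theorem of_injective_of_finiteIndex {f : G →* H} (hf : Function.Injective f)
    (hr : f.range.FiniteIndex) : RationalHomologySurjective f := by
  have h2 : RationalHomologySurjective (MonoidHom.ofInjective hf).toMonoidHom :=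
    of_rightInverse (MonoidHom.ofInjective hf).symm.toMonoidHom
      (MonoidHom.ext fun x => (MonoidHom.ofInjective hf).apply_symm_apply x)
  have h3 : f.range.subtype.comp (MonoidHom.ofInjective hf).toMonoidHom = f :=
    MonoidHom.ext fun x => MonoidHom.ofInjective_apply hf
  rw [← h3]
  exact (subtype_of_finiteIndex f.range).comp h2

theorem push_subtype_injective (S : Subgroup H) (n : ℕ) :
    Function.Injective (push S.subtype n) :=
  Finsupp.mapDomain_injective (Function.Injective.comp_left S.subtype_injective)

theorem diff_push (f : G →* H) (n : ℕ) (y : (Fin (n + 1) → G) →₀ ℚ) :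
    diff H n (push f (n + 1) y) = push f n (diff G n y) := by
  rw [← ofHomogeneous_toHomogeneous (n + 1) y, ← ofHomogeneous_boundary, ← ofHomogeneous_push,
    ← ofHomogeneous_push, ← ofHomogeneous_boundary, boundary_push]

theorem isCycle_of_push (S : Subgroup H) {n : ℕ} (w : (Fin n → S) →₀ ℚ)
    (h : IsCycle (push S.subtype n w)) : IsCycle w := by
  cases n with
  | zero => trivial
  | succ n =>
    have h' : diff H n (push S.subtype (n + 1) w) = 0 := h
    exact push_subtype_injective S n (by rw [← diff_push, h', map_zero])

theorem exists_push_subtype_eq (S : Subgroup H) {n : ℕ} (z : (Fin n → H) →₀ ℚ)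
    (hz : ∀ g ∈ z.support, ∀ i, g i ∈ S) : ∃ w : (Fin n → S) →₀ ℚ, push S.subtype n w = z := by
  refine ⟨∑ g ∈ z.support.attach, Finsupp.single (fun i => ⟨g.1 i, hz g.1 g.2 i⟩) (z g.1), ?_⟩
  rw [map_sum]
  conv_rhs => rw [← Finsupp.sum_single z, Finsupp.sum, ← Finset.sum_attach]
  refine Finset.sum_congr rfl fun g _ => ?_
  rw [push_single]
  rfl

/-- A cycle involves finitely many group elements, and it is already a cycle in every subgroup
containing them. -/
theorem exists_finset_forall_mem_range {n : ℕ} (x : groupHomology (Rep.trivial ℚ H ℚ) n) :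
    ∃ F : Finset H, ∀ S : Subgroup H, (∀ g ∈ F, g ∈ S) →
      ∃ y, rationalHomologyMap S.subtype n y = x := by
  classical
  obtain ⟨z, hz, rfl⟩ := exists_homologyClass x
  refine ⟨z.support.biUnion fun g => Finset.univ.image g, fun S hS => ?_⟩
  obtain ⟨w, rfl⟩ := exists_push_subtype_eq S z fun g hg i =>
    hS _ (Finset.mem_biUnion.mpr ⟨g, hg, Finset.mem_image_of_mem _ (Finset.mem_univ i)⟩)
  exact ⟨homologyClass w (isCycle_of_push S w hz), map_homologyClass S.subtype w _⟩

/-- Every homology class comes from a finitely generated subgroup, so surjectivity may be checked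
on subgroups containing a given finite set. -/
theorem of_finite_subsets {f : G →* H} (h : ∀ F : Finset H, ∃ S : Subgroup H, (∀ x ∈ F, x ∈ S) ∧
    ∃ (K : Type) (_ : Group K) (ψ : K →* S) (φ : K →* G),
      RationalHomologySurjective ψ ∧ f.comp φ = S.subtype.comp ψ) :
    RationalHomologySurjective f := by
  intro n x
  obtain ⟨F, hF⟩ := exists_finset_forall_mem_range x
  obtain ⟨S, hS, K, _, ψ, φ, hψ, hφ⟩ := h F
  obtain ⟨y, rfl⟩ := hF S hS
  obtain ⟨u, rfl⟩ := hψ n y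
  exact ⟨rationalHomologyMap φ n u, by
    rw [← rationalHomologyMap_comp_apply, hφ, rationalHomologyMap_comp_apply]⟩

end RationalHomologySurjective

/-! ### The augmentation ideal and the module `M ⊗ ℚ` -/

/-- By `ab - 1 = a(b - 1) + (a - 1)` the elements `c` with this property form a subgroup, and it
contains `t`. -/
theorem of_sub_one_mem_span (c : InfCyclic) :
    MonoidAlgebra.of ℚ InfCyclic c - 1 ∈ Ideal.span {tSubOne} := by
  let S : Subgroup InfCyclic :=
    { carrier := {c | MonoidAlgebra.of ℚ InfCyclic c - 1 ∈ Ideal.span {tSubOne}}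
      one_mem' := by
        rw [Set.mem_ofPred_eq, map_one, sub_self]
        exact zero_mem _
      mul_mem' := fun {a b} ha hb => by
        have h : MonoidAlgebra.of ℚ InfCyclic (a * b) - 1 =
            MonoidAlgebra.of ℚ InfCyclic a * (MonoidAlgebra.of ℚ InfCyclic b - 1) +
              (MonoidAlgebra.of ℚ InfCyclic a - 1) := by
          rw [map_mul]
          ring
        rw [Set.mem_ofPred_eq, h]
        exact Ideal.add_mem _ (Ideal.mul_mem_left _ _ hb) ha
      inv_mem' := fun {a} ha => by
        have h : MonoidAlgebra.of ℚ InfCyclic a⁻¹ - 1 =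
            -(MonoidAlgebra.of ℚ InfCyclic a⁻¹ * (MonoidAlgebra.of ℚ InfCyclic a - 1)) := by
          rw [mul_sub, ← map_mul, inv_mul_cancel, map_one]
          ring
        rw [Set.mem_ofPred_eq, h]
        exact neg_mem (Ideal.mul_mem_left _ _ ha) }
  have h : Subgroup.zpowers (Multiplicative.ofAdd (1 : ℤ)) ≤ S := by
    rw [Subgroup.zpowers_le]
    exact Ideal.subset_span rfl
  refine h (Subgroup.mem_zpowers_iff.mpr ⟨Multiplicative.toAdd c, ?_⟩)
  rw [← ofAdd_zsmul]
  simp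

/-- Modulo `t - 1` every element of the group ring equals its augmentation. Principality of `I`
turns `I ^ i W` into the image of a power of one operator. -/
theorem augIdeal_eq_span : augIdeal = Ideal.span {tSubOne} := by
  refine le_antisymm (fun x hx => ?_) (Ideal.span_le.mpr (by simpa using tSubOne_mem))
  have key (x : RatGroupRing) : x - algebraMap ℚ RatGroupRing (MonoidAlgebra.lift ℚ ℚ InfCyclic 1 x) ∈
      Ideal.span {tSubOne} := by
    induction x using MonoidAlgebra.induction_on with
    | of c =>
      rw [MonoidAlgebra.lift_of, MonoidHom.one_apply, map_one]
      exact of_sub_one_mem_span c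
    | add a b ha hb =>
      rw [map_add, map_add, add_sub_add_comm]
      exact add_mem ha hb
    | smul r a ha =>
      rw [map_smul, Algebra.algebraMap_eq_smul_one, smul_assoc, ← Algebra.algebraMap_eq_smul_one,
        ← smul_sub, Algebra.smul_def]
      exact Ideal.mul_mem_left _ _ ha
  have hx' : MonoidAlgebra.lift ℚ ℚ InfCyclic 1 x = 0 := hx
  simpa only [hx', map_zero, sub_zero] using key x

theorem of_sub_one_mem (c : InfCyclic) : MonoidAlgebra.of ℚ InfCyclic c - 1 ∈ augIdeal :=
  augIdeal_eq_span ▸ of_sub_one_mem_span c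

/-! ### The `I`-adic filtration of a `ℚ[C]`-module. -/

section Filtration

variable (W : Type*) [AddCommGroup W] [Module RatGroupRing W]

/-- The filtration by powers of the augmentation ideal. -/
abbrev augFiltration (i : ℕ) : Submodule RatGroupRing W := augIdeal ^ i • ⊤

variable {W}

theorem mem_augFiltration_succ {i : ℕ} {w : W} :
    w ∈ augFiltration W (i + 1) ↔ ∃ v ∈ augFiltration W i, tSubOne • v = w := by
  rw [augFiltration, pow_succ', Submodule.mul_smul, augIdeal_eq_span,
    Submodule.ideal_span_singleton_smul, ← augIdeal_eq_span]
  exact Submodule.mem_smul_pointwise_iff_exists _ _ _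

theorem smul_mem_augFiltration_succ {i : ℕ} {w : W} (hw : w ∈ augFiltration W i)
    {r : RatGroupRing} (hr : r ∈ augIdeal) : r • w ∈ augFiltration W (i + 1) := by
  rw [augFiltration, pow_succ', Submodule.mul_smul]
  exact Submodule.smul_mem_smul hr hw

theorem pow_smul_mem_augFiltration {i : ℕ} (w : W) {r : RatGroupRing} (hr : r ∈ augIdeal ^ i) :
    r • w ∈ augFiltration W i :=
  Submodule.smul_mem_smul hr trivial

theorem augFiltration_antitone : Antitone (augFiltration W) := fun _ _ h =>
  Submodule.smul_mono_left (Ideal.pow_le_pow_right h)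

theorem augFiltration_eq_range (i : ℕ) :
    augFiltration W i = LinearMap.range ((LinearMap.lsmul RatGroupRing W tSubOne) ^ i) := by
  induction i with
  | zero => simp [augFiltration, Module.End.one_eq_id]
  | succ i ih =>
    ext w
    rw [mem_augFiltration_succ, ih]
    simp only [LinearMap.mem_range, exists_exists_eq_and, pow_succ']
    rfl

/-- For a module of finite length the filtration stabilizes at a stage whose quotient splits
off. -/
theorem exists_stable_augFiltration [IsArtinian RatGroupRing W] [IsNoetherian RatGroupRing W] :
    ∃ N : ℕ, 1 ≤ N ∧ (∀ i, N ≤ i → augFiltration W i = augFiltration W N) ∧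
      ∃ s : (W ⧸ augFiltration W N) →ₗ[RatGroupRing] W,
        (augFiltration W N).mkQ ∘ₗ s = LinearMap.id := by
  obtain ⟨n₁, h₁⟩ := IsArtinian.monotone_stabilizes
    ((LinearMap.lsmul RatGroupRing W tSubOne).iterateRange)
  -- Fitting's decomposition: for large `n` the module is the direct sum of the kernel and the image
  -- of `(t - 1) ^ n`.
  obtain ⟨n₂, h₂⟩ := Filter.eventually_atTop.mp
    (LinearMap.lsmul RatGroupRing W tSubOne).eventually_isCompl_ker_pow_range_pow
  -- Stage `0` must be excluded: there the term of the central series is all of `G`, with trivial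
  -- quotient, while the truncated group is still `ℚ`.
  refine ⟨max 1 (max n₁ n₂), le_max_left _ _, fun i hi => ?_, ?_⟩
  · have h (j : ℕ) (hj : n₁ ≤ j) : augFiltration W j = augFiltration W n₁ := by
      rw [augFiltration_eq_range, augFiltration_eq_range]
      exact (h₁ j hj).symm
    rw [h i (by omega), h (max 1 (max n₁ n₂)) (by omega)]
  · set N := max 1 (max n₁ n₂)
    have hc := h₂ N (by omega)
    rw [← augFiltration_eq_range] at hc
    refine ⟨(LinearMap.ker ((LinearMap.lsmul RatGroupRing W tSubOne) ^ N)).subtype ∘ₗ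
      (Submodule.quotientEquivOfIsCompl _ _ hc.symm).toLinearMap, ?_⟩
    ext w
    exact Submodule.mk_quotientEquivOfIsCompl_apply hc.symm _

end Filtration

/-! ### Torsion and denominators for `M → M ⊗ ℚ`. -/

section RatModule

variable (M : Type u) [AddCommGroup M] [DistribMulAction InfCyclic M]

/-- The map `M → M ⊗ ℚ`. -/
def toRatModule : M →+ RatModule M where
  toFun m := (ratRep M).asModuleEquiv.symm ((1 : ℚ) ⊗ₜ[ℤ] m)
  map_zero' := by rw [TensorProduct.tmul_zero, map_zero]
  map_add' a b := by rw [TensorProduct.tmul_add, map_add]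

variable {M}

theorem toRatModule_smul (c : InfCyclic) (m : M) :
    toRatModule M (c • m) = MonoidAlgebra.of ℚ InfCyclic c • toRatModule M m := by
  change (ratRep M).asModuleEquiv.symm _ = _ • (ratRep M).asModuleEquiv.symm _
  rw [← Representation.asModuleEquiv_symm_map_rho]
  congr 1

/-- As a localization, `A → ℚ ⊗ A` has the torsion as kernel and is surjective up to denominators.
-/
theorem isLocalizedModule_mk_rat (A : Type*) [AddCommGroup A] :
    IsLocalizedModule (nonZeroDivisors ℤ) (TensorProduct.mk ℤ ℚ A 1) :=
  (isLocalizedModule_iff_isBaseChange (nonZeroDivisors ℤ) ℚ _).mpr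
    (TensorProduct.isBaseChange ℤ A ℚ)

theorem one_tmul_eq_zero_iff {A : Type*} [AddCommGroup A] (a : A) :
    (1 : ℚ) ⊗ₜ[ℤ] a = 0 ↔ ∃ k : ℕ, k ≠ 0 ∧ k • a = 0 := by
  have := isLocalizedModule_mk_rat A
  have h := IsLocalizedModule.eq_zero_iff (nonZeroDivisors ℤ) (TensorProduct.mk ℤ ℚ A 1) (m := a)
  rw [TensorProduct.mk_apply] at h
  rw [h]
  constructor
  · rintro ⟨c, hc⟩
    refine ⟨(c : ℤ).natAbs, Int.natAbs_ne_zero.mpr (nonZeroDivisors.coe_ne_zero c), ?_⟩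
    have hc' : (c : ℤ) • a = 0 := hc
    rcases Int.natAbs_eq (c : ℤ) with h | h
    · rw [h] at hc'
      exact_mod_cast hc'
    · rw [h, neg_smul, neg_eq_zero] at hc'
      exact_mod_cast hc'
  · rintro ⟨k, hk, hka⟩
    exact ⟨⟨k, mem_nonZeroDivisors_of_ne_zero (by exact_mod_cast hk)⟩, by
      change (k : ℤ) • a = 0
      exact_mod_cast hka⟩

theorem toRatModule_eq_zero_iff (m : M) :
    toRatModule M m = 0 ↔ ∃ k : ℕ, k ≠ 0 ∧ k • m = 0 := by
  rw [← one_tmul_eq_zero_iff]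
  exact (ratRep M).asModuleEquiv.symm.map_eq_zero_iff

theorem exists_nsmul_eq_toRatModule (v : RatModule M) :
    ∃ k : ℕ, k ≠ 0 ∧ ∃ m, toRatModule M m = k • v := by
  have := isLocalizedModule_mk_rat M
  obtain ⟨⟨m, c⟩, h⟩ := IsLocalizedModule.surj (nonZeroDivisors ℤ) (TensorProduct.mk ℤ ℚ M 1)
    ((ratRep M).asModuleEquiv v)
  have h' : (c : ℤ) • (ratRep M).asModuleEquiv v = (1 : ℚ) ⊗ₜ[ℤ] m := h
  have h2 : toRatModule M m = (c : ℤ) • v := by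
    change (ratRep M).asModuleEquiv.symm _ = _
    rw [← h', map_zsmul, LinearEquiv.symm_apply_apply]
  have hc := Int.natAbs_ne_zero.mpr (nonZeroDivisors.coe_ne_zero c)
  rcases Int.natAbs_eq (c : ℤ) with h | h
  · exact ⟨_, hc, m, by rw [h2]; nth_rewrite 1 [h]; exact natCast_zsmul _ _⟩
  · exact ⟨_, hc, -m, by
      rw [map_neg, h2]; nth_rewrite 1 [h]; rw [neg_smul, neg_neg]; exact natCast_zsmul _ _⟩

theorem isArtinian_ratModule (hM : Module.Finite ℚ (ℚ ⊗[ℤ] M)) :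
    IsArtinian RatGroupRing (RatModule M) ∧ IsNoetherian RatGroupRing (RatModule M) := by
  have : Module.Finite ℚ (RatModule M) := .equiv (ratRep M).asModuleEquiv.symm
  exact ⟨isArtinian_of_tower ℚ inferInstance, isNoetherian_of_tower ℚ inferInstance⟩

end RatModule

/-! ### Semidirect products with modules over the group ring -/

section Semidirect

variable (W : Type*) [AddCommGroup W] [Module RatGroupRing W]

/-- The action of `C` on a `ℚ[C]`-module. -/
def groupRingAction : InfCyclic →* MulAut (Multiplicative W) where
  toFun c := AddEquiv.toMultiplicative
    (DistribMulAction.toAddEquiv W ((MonoidAlgebra.of ℚ InfCyclic).toHomUnits c))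
  map_one' := by
    ext x
    simp
  map_mul' a b := by
    refine MulEquiv.ext fun x => ?_
    rw [map_mul]
    exact congrArg Multiplicative.ofAdd (mul_smul ((MonoidAlgebra.of ℚ InfCyclic).toHomUnits a)
      ((MonoidAlgebra.of ℚ InfCyclic).toHomUnits b) x.toAdd)

variable {W}

/-- Congruences between truncated binomial series become equalities of operators on `W / I ^ i W`.
-/
theorem smul_quotient_augFiltration_congr {i : ℕ} {r s : RatGroupRing} (h : r - s ∈ augIdeal ^ i)
    (x : W ⧸ augFiltration W i) : r • x = s • x := by
  obtain ⟨w, rfl⟩ := Submodule.mkQ_surjective _ x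
  rw [← map_smul, ← map_smul, ← sub_eq_zero, ← map_sub, ← sub_smul, Submodule.mkQ_apply,
    Submodule.Quotient.mk_eq_zero]
  exact pow_smul_mem_augFiltration w h

theorem truncPow_smul_add (α β : ℚ) (i : ℕ) (x : W ⧸ augFiltration W i) :
    truncPow (α + β) i • x = truncPow α i • truncPow β i • x := by
  rw [smul_smul, eq_comm]
  exact smul_quotient_augFiltration_congr (truncPow_add_mem α β i) x

theorem truncPow_zero_succ (i : ℕ) : truncPow 0 (i + 1) = 1 := by
  simp [truncPow, Ring.choose_zero_ite]

theorem truncPow_one_add_two (i : ℕ) :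
    truncPow 1 (i + 2) = MonoidAlgebra.of ℚ InfCyclic (Multiplicative.ofAdd 1) := by
  have h (k : ℕ) : Ring.choose (1 : ℚ) (k + 2) = 0 := by
    have := Ring.choose_natCast (R := ℚ) 1 (k + 2)
    rwa [Nat.cast_one, Nat.choose_eq_zero_of_lt (by omega), Nat.cast_zero] at this
  rw [truncPow, Finset.sum_range_succ', Finset.sum_range_succ']
  simp [h, tSubOne]

theorem truncPow_zero_smul (i : ℕ) (x : W ⧸ augFiltration W i) : truncPow 0 i • x = x := by
  conv_rhs => rw [← one_smul RatGroupRing x, ← truncPow_zero_succ i]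
  refine smul_quotient_augFiltration_congr ?_ x
  rw [← neg_sub]
  exact neg_mem (truncPow_sub_mem 0 (Nat.le_succ i))

theorem truncPow_one_smul (i : ℕ) (x : W ⧸ augFiltration W i) :
    truncPow 1 i • x = MonoidAlgebra.of ℚ InfCyclic (Multiplicative.ofAdd 1) • x := by
  -- Two extra terms are harmless modulo `I ^ i` and make `1 + (t - 1) = t` exact even for `i ≤ 1`.
  rw [← truncPow_one_add_two i]
  refine smul_quotient_augFiltration_congr ?_ x
  rw [← neg_sub]
  exact neg_mem (truncPow_sub_mem 1 (Nat.le_add_right i 2))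

variable (W) in
/-- The action of `ℚ` on `W / I ^ i W` by binomial series. -/
def truncAction (i : ℕ) : Multiplicative ℚ →* MulAut (Multiplicative (W ⧸ augFiltration W i)) where
  toFun α := AddEquiv.toMultiplicative
    { toFun := fun x => truncPow α.toAdd i • x
      invFun := fun x => truncPow (-α.toAdd) i • x
      left_inv := fun x => by
        change truncPow (-α.toAdd) i • truncPow α.toAdd i • x = x
        rw [← truncPow_smul_add, neg_add_cancel, truncPow_zero_smul]
      right_inv := fun x => by
        change truncPow α.toAdd i • truncPow (-α.toAdd) i • x = x
        rw [← truncPow_smul_add, add_neg_cancel, truncPow_zero_smul]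
      map_add' := fun x y => smul_add _ x y }
  map_one' := MulEquiv.ext fun x => congrArg Multiplicative.ofAdd (truncPow_zero_smul i x.toAdd)
  map_mul' α β := MulEquiv.ext fun x =>
    congrArg Multiplicative.ofAdd (truncPow_smul_add α.toAdd β.toAdd i x.toAdd)

theorem toAdd_truncAction (i : ℕ) (α : Multiplicative ℚ)
    (x : Multiplicative (W ⧸ augFiltration W i)) :
    (truncAction W i α x).toAdd = truncPow α.toAdd i • x.toAdd := rfl

variable (W) in
/-- The group `(W / I ^ i W) ⋊ ℚ`. -/
abbrev TruncSemidirect (i : ℕ) : Type _ :=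
  Multiplicative (W ⧸ augFiltration W i) ⋊[truncAction W i] Multiplicative ℚ

variable (W) in
/-- The group `W ⋊ C`. -/
abbrev ModuleSemidirect : Type _ :=
  Multiplicative W ⋊[groupRingAction W] InfCyclic

/-- The inclusion of `ℤ` in `ℚ`. -/
def intToRat : InfCyclic →* Multiplicative ℚ :=
  AddMonoidHom.toMultiplicative (Int.castAddHom ℚ)

theorem intToRat_injective : Function.Injective intToRat := fun a b h => by
  have h' : ((a.toAdd : ℤ) : ℚ) = (b.toAdd : ℤ) := h
  exact Multiplicative.toAdd.injective (by exact_mod_cast h')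

theorem truncAction_intToRat (i : ℕ) :
    (truncAction W i).comp intToRat = groupRingAction (W ⧸ augFiltration W i) := by
  refine MonoidHom.ext_mint (MulEquiv.ext fun x => ?_)
  refine congrArg Multiplicative.ofAdd ?_
  change truncPow ((1 : ℤ) : ℚ) i • x.toAdd = _
  rw [Int.cast_one, truncPow_one_smul]
  rfl

/-- The inclusion `(W / I ^ i W) ⋊ C → (W / I ^ i W) ⋊ ℚ`. -/
def toTruncSemidirect (i : ℕ) :
    ModuleSemidirect (W ⧸ augFiltration W i) →* TruncSemidirect W i :=
  SemidirectProduct.map (MonoidHom.id _) intToRat fun c => by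
    rw [← truncAction_intToRat]
    rfl

/-- The map of semidirect products with `C` induced by a linear map. -/
def moduleSemidirectMap {W' : Type*} [AddCommGroup W'] [Module RatGroupRing W']
    (f : W →ₗ[RatGroupRing] W') : ModuleSemidirect W →* ModuleSemidirect W' :=
  SemidirectProduct.map f.toAddMonoidHom.toMultiplicative (MonoidHom.id _) fun c => by
    ext x
    exact congrArg Multiplicative.ofAdd (f.map_smul _ _)

variable (W) in
/-- The transition map `W / I ^ (i + 1) W → W / I ^ i W`. -/
def augTransition (i : ℕ) :
    (W ⧸ augFiltration W (i + 1)) →ₗ[RatGroupRing] W ⧸ augFiltration W i :=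
  Submodule.factor (augFiltration_antitone (Nat.le_succ i))

/-- The transition map `(W / I ^ (i + 1) W) ⋊ ℚ → (W / I ^ i W) ⋊ ℚ`. -/
def truncSemidirectTransition (i : ℕ) : TruncSemidirect W (i + 1) →* TruncSemidirect W i :=
  SemidirectProduct.map (augTransition W i).toAddMonoidHom.toMultiplicative
    (MonoidHom.id _) fun α => by
    refine MonoidHom.ext fun (x : W ⧸ augFiltration W (i + 1)) => ?_
    refine congrArg Multiplicative.ofAdd ?_
    change augTransition W i (truncPow α.toAdd (i + 1) • x) =
      truncPow α.toAdd i • augTransition W i x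
    rw [map_smul]
    exact smul_quotient_augFiltration_congr (truncPow_sub_mem _ (Nat.le_succ i)) _

theorem truncSemidirect_pow (i : ℕ) (g : TruncSemidirect W i) (n : ℕ) :
    g ^ n = ⟨Multiplicative.ofAdd
      ((∑ k ∈ Finset.range n, truncPow (k * g.right.toAdd) i) • g.left.toAdd), g.right ^ n⟩ := by
  induction n with
  | zero =>
    ext <;> simp
  | succ n ih =>
    rw [pow_succ, ih]
    refine SemidirectProduct.ext ?_ ?_
    · rw [SemidirectProduct.mul_left]
      apply Multiplicative.toAdd.injective
      rw [toAdd_mul, toAdd_truncAction, Finset.sum_range_succ, add_smul]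
      simp
    · rw [SemidirectProduct.mul_right, pow_succ]

theorem truncPow_sub_one_mem (α : ℚ) (i : ℕ) : truncPow α (i + 1) - 1 ∈ augIdeal := by
  have h := truncPow_sub_mem α (Nat.le_add_left 1 i)
  simpa [truncPow] using h

/-- Dividing by `n` makes `r` congruent to `1` modulo `I`, and `I` acts nilpotently on `W / I ^ i
W`; the finite geometric series provides the inverse. -/
theorem smul_quotient_bijective {i : ℕ} {r : RatGroupRing} {n : ℕ} (hn : n ≠ 0)
    (hr : r - n ∈ augIdeal) : Function.Bijective fun x : W ⧸ augFiltration W i => r • x := by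
  let q : RatGroupRing := algebraMap ℚ RatGroupRing (n : ℚ)⁻¹
  have hq : q * n = 1 := by
    rw [← map_natCast (algebraMap ℚ RatGroupRing), ← map_mul,
      inv_mul_cancel₀ (by exact_mod_cast hn), map_one]
  have ha : 1 - q * r ∈ augIdeal := by
    have h : 1 - q * r = -(q * (r - n)) := by rw [mul_sub, hq]; ring
    rw [h]
    exact neg_mem (Ideal.mul_mem_left _ _ hr)
  let s : RatGroupRing := (∑ k ∈ Finset.range i, (1 - q * r) ^ k) * q
  have hs : s * r - 1 ∈ augIdeal ^ i := by
    have h : s * r - 1 = -(1 - q * r) ^ i := by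
      have h1 := geom_sum_mul (1 - q * r) i
      have h2 : s * r - 1 = -((∑ k ∈ Finset.range i, (1 - q * r) ^ k) * (1 - q * r - 1)) - 1 := by
        simp only [s]
        ring
      rw [h2, h1]
      ring
    rw [h]
    exact neg_mem (Ideal.pow_mem_pow ha i)
  have h1 (x : W ⧸ augFiltration W i) : s • r • x = x := by
    rw [smul_smul, smul_quotient_augFiltration_congr hs, one_smul]
  refine Function.bijective_iff_has_inverse.mpr ⟨fun x => s • x, h1, fun x => ?_⟩
  change r • s • x = x
  rw [smul_comm, h1]

/-- The `ℚ`-coordinate `α` of a root is found by division by `n`; the module coordinate then solves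
a linear equation with coefficient `∑ t ^ (kα)`, `k < n`, whose augmentation is `n`. -/
theorem isUniquelyDivisible_truncSemidirect (i : ℕ) :
    IsUniquelyDivisible (TruncSemidirect W (i + 1)) := by
  intro n hn
  have hb (α : ℚ) : Function.Bijective fun x : W ⧸ augFiltration W (i + 1) =>
      (∑ k ∈ Finset.range n, truncPow (k * α) (i + 1)) • x := by
    refine smul_quotient_bijective hn ?_
    have h : (∑ k ∈ Finset.range n, truncPow (k * α) (i + 1)) - (n : RatGroupRing) =
        ∑ k ∈ Finset.range n, (truncPow (k * α) (i + 1) - 1) := by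
      simp
    rw [h]
    exact sum_mem fun k _ => truncPow_sub_one_mem _ _
  have hn' : (n : ℚ) ≠ 0 := by exact_mod_cast hn
  constructor
  · intro g h hgh
    simp only [truncSemidirect_pow] at hgh
    have h1 : g.right ^ n = h.right ^ n := congrArg SemidirectProduct.right hgh
    have h2 : g.right = h.right := by
      have h3 := congrArg Multiplicative.toAdd h1
      rw [toAdd_pow, toAdd_pow, nsmul_eq_mul, nsmul_eq_mul] at h3
      exact Multiplicative.toAdd.injective (mul_left_cancel₀ hn' h3)
    refine SemidirectProduct.ext (Multiplicative.toAdd.injective ((hb g.right.toAdd).1 ?_)) h2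
    have h4 := congrArg (fun x => Multiplicative.toAdd (SemidirectProduct.left x)) hgh
    simp only [toAdd_ofAdd] at h4
    rw [← h2] at h4
    exact h4
  · intro g
    obtain ⟨x, hx⟩ := (hb (g.right.toAdd / n)).2 g.left.toAdd
    refine ⟨⟨Multiplicative.ofAdd x, Multiplicative.ofAdd (g.right.toAdd / n)⟩, ?_⟩
    simp only [truncSemidirect_pow]
    refine SemidirectProduct.ext (Multiplicative.toAdd.injective hx)
      (Multiplicative.toAdd.injective ?_)
    rw [toAdd_pow, toAdd_ofAdd, nsmul_eq_mul, mul_div_cancel₀ _ hn']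

end Semidirect

/-! ### The comparison map from `M ⋊ C` to the truncated groups. -/

section Metabelian

variable (M : Type u) [AddCommGroup M] [DistribMulAction InfCyclic M]

/-- The map `M ⋊ C → (M ⊗ ℚ) ⋊ C`. -/
def rationalizeModule : MetabelianOverC M →* ModuleSemidirect (RatModule M) :=
  SemidirectProduct.map (toRatModule M).toMultiplicative (MonoidHom.id _) fun c => by
    ext x
    exact congrArg Multiplicative.ofAdd (toRatModule_smul c x)

/-- The map `M ⋊ C → (M ⊗ ℚ / I ^ i) ⋊ ℚ`. -/
def metabelianToTrunc (i : ℕ) : MetabelianOverC M →* TruncSemidirect (RatModule M) i :=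
  (toTruncSemidirect i).comp
    ((moduleSemidirectMap (augFiltration (RatModule M) i).mkQ).comp (rationalizeModule M))

variable {M}

theorem toAdd_metabelianToTrunc_left (i : ℕ) (g : MetabelianOverC M) :
    (metabelianToTrunc M i g).left.toAdd =
      (augFiltration (RatModule M) i).mkQ (toRatModule M g.left.toAdd) := rfl

theorem metabelianToTrunc_right (i : ℕ) (g : MetabelianOverC M) :
    (metabelianToTrunc M i g).right = intToRat g.right := rfl

theorem metabelianToTrunc_eq_one_iff (i : ℕ) (g : MetabelianOverC M) :
    metabelianToTrunc M i g = 1 ↔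
      g.right = 1 ∧ toRatModule M g.left.toAdd ∈ augFiltration (RatModule M) i := by
  rw [SemidirectProduct.ext_iff, metabelianToTrunc_right, SemidirectProduct.one_right,
    map_eq_one_iff _ intToRat_injective, and_comm, SemidirectProduct.one_left,
    ← Multiplicative.toAdd.injective.eq_iff (a := (metabelianToTrunc M i g).left),
    toAdd_metabelianToTrunc_left, toAdd_one,
    Submodule.mkQ_apply, Submodule.Quotient.mk_eq_zero]

end Metabelian

/-! ### Finiteness of quotients -/

theorem Subgroup.finiteIndex_of_separating {G T : Type*} [Group G] [Finite T] (H : Subgroup G)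
    (q : G → T) (hq : ∀ x y, q x = q y → x⁻¹ * y ∈ H) : H.FiniteIndex := by
  have : Finite (G ⧸ H) := by
    refine Finite.of_injective (fun c : G ⧸ H => q c.out) fun a b hab => ?_
    rw [← QuotientGroup.out_eq' a, ← QuotientGroup.out_eq' b, QuotientGroup.eq]
    exact hq _ _ hab
  exact Subgroup.finiteIndex_of_finite_quotient

/-- A torsion-free abelian group of finite rank is finite modulo `N`. -/
theorem AddSubgroup.finite_quotient_nsmul_range {V : Type*} [AddCommGroup V] [Module ℚ V]
    [Module.Finite ℚ V] (A : AddSubgroup V) {N : ℕ} (hN : N ≠ 0) :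
    Finite (A ⧸ (nsmulAddMonoidHom N : A →+ A).range) := by
  have : NeZero N := ⟨hN⟩
  by_contra hfin
  have : Infinite (A ⧸ (nsmulAddMonoidHom N : A →+ A).range) := not_finite_iff_infinite.mp hfin
  -- Pigeonhole: representatives of the chosen classes span a free group of rank at most `dim V`,
  -- whose coordinates modulo `N` take at most `N ^ dim V` values, one fewer than the number of
  -- classes.
  obtain ⟨T, -, hT⟩ := Set.infinite_univ.exists_subset_card_eq
    (α := A ⧸ (nsmulAddMonoidHom N : A →+ A).range) (N ^ Module.finrank ℚ V + 1)
  let A₀ : Submodule ℤ V := Submodule.span ℤ 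
    ((fun t : A ⧸ (nsmulAddMonoidHom N : A →+ A).range => (t.out : V)) '' (T : Set _))
  have hA₀ (v : V) (hv : v ∈ A₀) : v ∈ A := by
    have h : A₀ ≤ AddSubgroup.toIntSubmodule A := by
      refine Submodule.span_le.mpr ?_
      rintro _ ⟨t, -, rfl⟩
      exact (Quotient.out t).2
    exact h hv
  have hmem (t : T) : (t.1.out : V) ∈ A₀ := Submodule.subset_span ⟨t.1, t.2, rfl⟩
  have : Module.Finite ℤ A₀ :=
    Module.Finite.iff_fg.mpr (Submodule.fg_span ((Finset.finite_toSet T).image _))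
  have : IsAddTorsionFree V := IsAddTorsionFree.of_module_rat V
  have : Module.Free ℤ A₀ := inferInstance
  let b := Module.Free.chooseBasis ℤ A₀
  have hrank : Fintype.card (Module.Free.ChooseBasisIndex ℤ A₀) ≤ Module.finrank ℚ V := by
    have h := b.linearIndependent.map' A₀.subtype (Submodule.ker_subtype _)
    exact ((LinearIndependent.iff_fractionRing ℤ ℚ).mp h).fintype_card_le_finrank
  let f (t : T) : Module.Free.ChooseBasisIndex ℤ A₀ → ZMod N :=
    fun i => (b.repr ⟨_, hmem t⟩ i : ZMod N)
  have hf : Function.Injective f := by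
    intro t t' h
    have hdvd (i) : ∃ c : ℤ, b.repr ⟨_, hmem t'⟩ i - b.repr ⟨_, hmem t⟩ i = N * c := by
      have h1 : ((b.repr ⟨_, hmem t⟩ i : ℤ) : ZMod N) = (b.repr ⟨_, hmem t'⟩ i : ℤ) :=
        congrFun h i
      rw [ZMod.intCast_eq_intCast_iff_dvd_sub] at h1
      exact h1
    choose c hc using hdvd
    let a : A₀ := ∑ i, c i • b i
    have ha : (⟨_, hmem t'⟩ : A₀) - ⟨_, hmem t⟩ = N • a := by
      apply b.repr.injective
      ext i
      rw [map_sub, Finsupp.sub_apply, hc]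
      simp [a, map_sum, Finsupp.single_apply]
    apply Subtype.ext
    rw [← QuotientAddGroup.out_eq' t.1, ← QuotientAddGroup.out_eq' t'.1, QuotientAddGroup.eq]
    refine ⟨⟨a, hA₀ _ a.2⟩, Subtype.ext ?_⟩
    have ha' := congrArg Subtype.val ha
    simp only [nsmulAddMonoidHom_apply, AddSubgroup.coe_nsmul, AddSubgroup.coe_add,
      AddSubgroup.coe_neg] at ha' ⊢
    rw [neg_add_eq_sub]
    exact ha'.symm
  have hcard := Fintype.card_le_of_injective f hf
  rw [Fintype.card_coe, hT, Fintype.card_fun, ZMod.card] at hcard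
  have h2 := hcard.trans (Nat.pow_le_pow_right (Nat.pos_of_ne_zero hN) hrank)
  omega

/-! ### Removing torsion from finitely generated `ℤ[C]`-modules. -/

section Torsion

variable {M : Type*} [AddCommGroup M] [DistribMulAction InfCyclic M]

/-- Finitely many elements of a module over the Noetherian ring `ℤ[C]` have nonzero multiples in
a torsion-free submodule. -/
theorem exists_invariant_torsionFree_addSubgroup (S : Finset M) :
    ∃ B : AddSubgroup M, (∀ (c : InfCyclic), ∀ m ∈ B, c • m ∈ B) ∧
      (∃ e : ℕ, e ≠ 0 ∧ ∀ m ∈ S, e • m ∈ B) ∧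
      ∀ m ∈ B, (∃ k : ℕ, k ≠ 0 ∧ k • m = 0) → m = 0 := by
  let ρ := Representation.ofDistribMulAction ℤ InfCyclic M
  have : IsNoetherianRing (MonoidAlgebra ℤ InfCyclic) := by
    have : Monoid.FG InfCyclic := inferInstance
    exact Algebra.FiniteType.isNoetherianRing ℤ _
  let M₀ : Submodule (MonoidAlgebra ℤ InfCyclic) ρ.asModule :=
    Submodule.span _ (ρ.asModuleEquiv.symm '' (S : Set M))
  have hM₀ : M₀.FG := Submodule.fg_span ((Finset.finite_toSet S).image _)
  let tors : Submodule (MonoidAlgebra ℤ InfCyclic) ρ.asModule :=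
    { carrier := {m | ∃ k : ℕ, k ≠ 0 ∧ k • m = 0}
      zero_mem' := ⟨1, one_ne_zero, smul_zero _⟩
      add_mem' := by
        rintro a b ⟨k, hk, ha⟩ ⟨l, hl, hb⟩
        refine ⟨k * l, mul_ne_zero hk hl, ?_⟩
        rw [smul_add, mul_comm, mul_smul, ha, mul_comm, mul_smul, hb, smul_zero, smul_zero,
          add_zero]
      smul_mem' := by
        rintro r a ⟨k, hk, ha⟩
        exact ⟨k, hk, by rw [smul_comm, ha, smul_zero]⟩ }
  have : IsNoetherian (MonoidAlgebra ℤ InfCyclic) M₀ := isNoetherian_of_fg_of_noetherian M₀ hM₀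
  obtain ⟨s, hs⟩ : (tors ⊓ M₀).FG := by
    have h := (IsNoetherian.noetherian (tors.comap M₀.subtype)).map M₀.subtype
    rwa [Submodule.map_comap_subtype, inf_comm] at h
  -- The torsion of `M₀` is finitely generated by Noetherianity, so one integer `e` kills it.
  obtain ⟨e, he, hes⟩ : ∃ e : ℕ, e ≠ 0 ∧ ∀ m ∈ tors ⊓ M₀, e • m = 0 := by
    have hs' (m : ρ.asModule) : ∃ k : ℕ, k ≠ 0 ∧ (m ∈ s → k • m = 0) := by
      by_cases h : m ∈ s
      · obtain ⟨k, hk, hm⟩ : m ∈ tors :=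
          (hs ▸ Submodule.subset_span h : m ∈ tors ⊓ M₀).1
        exact ⟨k, hk, fun _ => hm⟩
      · exact ⟨1, one_ne_zero, fun h' => absurd h' h⟩
    choose k hk hks using hs'
    refine ⟨∏ m ∈ s, k m, Finset.prod_ne_zero_iff.mpr fun m _ => hk m, fun m hm => ?_⟩
    rw [← hs] at hm
    induction hm using Submodule.span_induction with
    | mem m hm =>
      obtain ⟨l, hl⟩ := Finset.dvd_prod_of_mem k hm
      rw [hl, mul_comm, mul_smul, hks m hm, smul_zero]
    | zero => exact smul_zero _
    | add a b _ _ ha hb => rw [smul_add, ha, hb, add_zero]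
    | smul r a _ ha => rw [smul_comm, ha, smul_zero]
  -- The submodule is `e M₀`: if `e m` is torsion then so is `m`, and therefore `e m = 0`.
  refine ⟨(M₀.toAddSubgroup.map (nsmulAddMonoidHom e)).map ρ.asModuleEquiv.toAddEquiv.toAddMonoidHom,
    ?_, ⟨e, he, ?_⟩, ?_⟩
  · rintro c _ ⟨_, ⟨m, hm, rfl⟩, rfl⟩
    refine ⟨_, ⟨MonoidAlgebra.of ℤ InfCyclic c • m, M₀.smul_mem _ hm, rfl⟩, ?_⟩
    have h := ρ.asModuleEquiv_symm_map_rho c (ρ.asModuleEquiv m)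
    rw [LinearEquiv.symm_apply_apply] at h
    rw [← h]
    change e • (c • ρ.asModuleEquiv m) = c • ρ.asModuleEquiv (e • m)
    rw [map_nsmul, smul_comm]
  · intro m hm
    exact ⟨_, ⟨ρ.asModuleEquiv.symm m, Submodule.subset_span ⟨m, hm, rfl⟩, rfl⟩, rfl⟩
  · rintro _ ⟨_, ⟨m, hm, rfl⟩, rfl⟩ ⟨k, hk, h⟩
    have h1 : e • m = 0 := by
      refine hes m ⟨⟨k * e, mul_ne_zero hk he, ?_⟩, hm⟩
      rw [mul_smul]
      exact h
    exact h1

end Torsion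

/-! ### Surjectivity on homology for metabelian groups -/

open RationalHomologySurjective

section

variable {W : Type} [AddCommGroup W] [Module RatGroupRing W]

theorem rationalHomologySurjective_moduleSemidirectMap {W' : Type} [AddCommGroup W']
    [Module RatGroupRing W'] (f : W →ₗ[RatGroupRing] W') (s : W' →ₗ[RatGroupRing] W)
    (h : f ∘ₗ s = LinearMap.id) : RationalHomologySurjective (moduleSemidirectMap f) := by
  refine of_rightInverse (moduleSemidirectMap s) (MonoidHom.ext fun x => ?_)
  exact SemidirectProduct.ext (congrArg Multiplicative.ofAdd (LinearMap.congr_fun h x.left.toAdd))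
    rfl

/-- Finitely many elements have `ℚ`-coordinates in `(1/d)ℤ`, and `ℤ` has finite index there. -/
theorem rationalHomologySurjective_toTruncSemidirect (i : ℕ) :
    RationalHomologySurjective (toTruncSemidirect i : _ →* TruncSemidirect W i) := by
  classical
  refine of_finite_subsets fun F => ?_
  let d : ℕ := ∏ g ∈ F, g.right.toAdd.den
  have hd : d ≠ 0 := Finset.prod_ne_zero_iff.mpr fun g _ => g.right.toAdd.den_nz
  have : NeZero d := ⟨hd⟩
  let S : Subgroup (TruncSemidirect W i) :=
    (AddSubgroup.toSubgroup ((Int.castAddHom ℚ).range.comap (nsmulAddMonoidHom d))).comap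
      SemidirectProduct.rightHom
  have hS (g : TruncSemidirect W i) : g ∈ S ↔ ∃ n : ℤ, (n : ℚ) = d * g.right.toAdd := by
    rw [← nsmul_eq_mul]
    rfl
  have hmem (g : ModuleSemidirect (W ⧸ augFiltration W i)) : toTruncSemidirect i g ∈ S :=
    (hS _).mpr ⟨d * g.right.toAdd, by push_cast; rfl⟩
  refine ⟨S, fun g hg => (hS g).mpr ?_, _, inferInstance,
    (toTruncSemidirect i).codRestrict S hmem, MonoidHom.id _, ?_, rfl⟩
  · obtain ⟨k, hk⟩ := Finset.dvd_prod_of_mem (fun g : TruncSemidirect W i => g.right.toAdd.den) hg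
    refine ⟨k * g.right.toAdd.num, ?_⟩
    change _ = ((∏ g ∈ F, g.right.toAdd.den : ℕ) : ℚ) * _
    rw [hk]
    push_cast
    rw [mul_right_comm, Rat.den_mul_eq_num, mul_comm]
  · refine of_injective_of_finiteIndex (fun a b h => ?_) ?_
    · have h' : toTruncSemidirect i a = toTruncSemidirect i b := congrArg Subtype.val h
      have hl : (toTruncSemidirect i a).left = (toTruncSemidirect i b).left := by rw [h']
      have hr : (toTruncSemidirect i a).right = (toTruncSemidirect i b).right := by rw [h']
      exact SemidirectProduct.ext hl (intToRat_injective hr)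
    · choose n hn using fun g : S => (hS g.1).mp g.2
      -- Elements whose numerators over `d` agree modulo `d` differ by an integral element.
      refine Subgroup.finiteIndex_of_separating _ (fun g => (n g : ZMod d)) fun x y h => ?_
      rw [ZMod.intCast_eq_intCast_iff_dvd_sub] at h
      obtain ⟨c, hc⟩ := h
      refine ⟨⟨(x⁻¹ * y).1.left, Multiplicative.ofAdd c⟩, Subtype.ext ?_⟩
      refine SemidirectProduct.ext rfl (Multiplicative.toAdd.injective ?_)
      change (c : ℚ) = -x.1.right.toAdd + y.1.right.toAdd
      have hc' : (n y : ℚ) - n x = d * c := by exact_mod_cast hc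
      rw [hn, hn, ← mul_sub] at hc'
      rw [← mul_left_cancel₀ (Nat.cast_ne_zero.mpr hd) hc', neg_add_eq_sub]

end

section

variable {M : Type} [AddCommGroup M] [DistribMulAction InfCyclic M]

/-- Take a `C`-stable torsion-free `B ⊆ M` and let `A` be the set of `v` with `N v` in the image of
`B`. For suitable `N` the group `A ⋊ C` contains the given elements. It contains `B ⋊ C` with finite
index, because `N A` lies in the image of `B` and `A / N A` is finite. -/
theorem rationalHomologySurjective_rationalizeModule (hM : Module.Finite ℚ (ℚ ⊗[ℤ] M)) :
    RationalHomologySurjective (rationalizeModule M) := by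
  classical
  refine of_finite_subsets fun F => ?_
  choose k hk m hm using fun v : RatModule M => exists_nsmul_eq_toRatModule v
  obtain ⟨B, hBC, ⟨e, he, hBe⟩, hB0⟩ := exists_invariant_torsionFree_addSubgroup
    (F.image fun g => m g.left.toAdd)
  -- The factors `k` clear the denominators of the given vectors, and `e` moves the resulting
  -- elements of `M` into `B`.
  let N : ℕ := e * ∏ g ∈ F, k g.left.toAdd
  have hN : N ≠ 0 := mul_ne_zero he (Finset.prod_ne_zero_iff.mpr fun g _ => hk _)
  let A : AddSubgroup (RatModule M) := (B.map (toRatModule M)).comap (nsmulAddMonoidHom N)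
  have hA (v : RatModule M) : v ∈ A ↔ ∃ b ∈ B, toRatModule M b = N • v := Iff.rfl
  have hAC (c : InfCyclic) (v : RatModule M) (hv : v ∈ A) :
      MonoidAlgebra.of ℚ InfCyclic c • v ∈ A := by
    obtain ⟨b, hb, h⟩ := (hA v).mp hv
    exact (hA _).mpr ⟨c • b, hBC c b hb, by rw [toRatModule_smul, h, smul_comm]⟩
  let S : Subgroup (ModuleSemidirect (RatModule M)) :=
    { carrier := {g | g.left.toAdd ∈ A}
      one_mem' := A.zero_mem
      mul_mem' := fun {x y} hx hy => A.add_mem hx (hAC x.right _ hy)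
      inv_mem' := fun {x} hx => hAC x.right⁻¹ _ (A.neg_mem hx) }
  let K : Subgroup (MetabelianOverC M) :=
    { carrier := {g | g.left.toAdd ∈ B}
      one_mem' := B.zero_mem
      mul_mem' := fun {x y} hx hy => B.add_mem hx (hBC x.right _ hy)
      inv_mem' := fun {x} hx => hBC x.right⁻¹ _ (B.neg_mem hx) }
  have hmem (g : K) : rationalizeModule M g.1 ∈ S :=
    (hA _).mpr ⟨N • g.1.left.toAdd, B.nsmul_mem g.2 N, map_nsmul _ _ _⟩
  refine ⟨S, fun g hg => (hA _).mpr ?_, K, inferInstance,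
    ((rationalizeModule M).comp K.subtype).codRestrict S hmem, K.subtype, ?_, rfl⟩
  · obtain ⟨l, hl⟩ := Finset.dvd_prod_of_mem
      (fun g : ModuleSemidirect (RatModule M) => k g.left.toAdd) hg
    refine ⟨l • e • m g.left.toAdd, B.nsmul_mem (hBe _ (Finset.mem_image_of_mem _ hg)) l, ?_⟩
    rw [map_nsmul, map_nsmul, hm, smul_smul, smul_smul]
    congr 1
    change l * e * k g.left.toAdd = e * ∏ g ∈ F, k g.left.toAdd
    rw [hl]
    ring
  · refine of_injective_of_finiteIndex ?_ ?_
    · rw [injective_iff_map_eq_one]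
      intro g hg
      have hg' : rationalizeModule M g.1 = 1 := congrArg Subtype.val hg
      have h1 : toRatModule M g.1.left.toAdd = 0 := congrArg SemidirectProduct.left hg'
      have h2 : g.1.right = 1 := congrArg SemidirectProduct.right hg'
      exact Subtype.ext (SemidirectProduct.ext
        (hB0 _ g.2 ((toRatModule_eq_zero_iff _).mp h1)) h2)
    · have : Module.Finite ℚ (RatModule M) := .equiv (ratRep M).asModuleEquiv.symm
      have := A.finite_quotient_nsmul_range hN
      refine Subgroup.finiteIndex_of_separating _
        (fun g : S => (QuotientAddGroup.mk (⟨g.1.left.toAdd, g.2⟩ : A) :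
          A ⧸ (nsmulAddMonoidHom N : A →+ A).range)) fun x y h => ?_
      rw [QuotientAddGroup.eq] at h
      obtain ⟨a, ha⟩ := h
      have ha' : N • (a : RatModule M) = -x.1.left.toAdd + y.1.left.toAdd :=
        congrArg Subtype.val ha
      obtain ⟨b, hb, hba⟩ := (hA _).mp a.2
      -- The twist by `x.1.right⁻¹` is the one in the module coordinate of `x⁻¹ * y`.
      refine ⟨⟨⟨Multiplicative.ofAdd (x.1.right⁻¹ • b), x.1.right⁻¹ * y.1.right⟩,
        hBC _ _ hb⟩, Subtype.ext (SemidirectProduct.ext ?_ rfl)⟩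
      apply Multiplicative.toAdd.injective
      change toRatModule M (x.1.right⁻¹ • b) =
        MonoidAlgebra.of ℚ InfCyclic x.1.right⁻¹ • (-x.1.left.toAdd) +
          MonoidAlgebra.of ℚ InfCyclic x.1.right⁻¹ • y.1.left.toAdd
      rw [toRatModule_smul, hba, ha', smul_add]

theorem rationalHomologySurjective_metabelianToTrunc (hM : Module.Finite ℚ (ℚ ⊗[ℤ] M)) (N : ℕ)
    (s : (RatModule M ⧸ augFiltration (RatModule M) N) →ₗ[RatGroupRing] RatModule M)
    (hs : (augFiltration (RatModule M) N).mkQ ∘ₗ s = LinearMap.id) :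
    RationalHomologySurjective (metabelianToTrunc M N) :=
  (rationalHomologySurjective_toTruncSemidirect N).comp
    ((rationalHomologySurjective_moduleSemidirectMap _ s hs).comp
      (rationalHomologySurjective_rationalizeModule hM))

end

/-! ### Central extensions and Malcev completions -/

namespace MalcevCompletion

variable {N Q : Type u} [Group N] [Group Q]

/-- The conjugate of `y` by `x` has the same `n`-th power as `y`, and roots are unique. -/
theorem commute_of_commute_pow {H : Type*} [Group H] (hH : IsUniquelyDivisible H) {n : ℕ}
    (hn : n ≠ 0) {x y : H} (h : Commute x (y ^ n)) : Commute x y := by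
  have h1 : (x * y * x⁻¹) ^ n = y ^ n := by
    rw [conj_pow, h.eq, mul_inv_cancel_right]
  exact mul_inv_eq_iff_eq_mul.mp ((hH n hn).1 h1)

theorem of_mem_center {z : N} (hz : z ∈ Subgroup.center N) :
    of z ∈ Subgroup.center (MalcevCompletion N) := by
  rw [Subgroup.mem_center_iff]
  intro g
  have hg : g ∈ Subgroup.centralizer {of z} := by
    refine mem_of_closed _ (fun x => ?_) (fun n y hn hy => ?_) g
    · rw [Subgroup.mem_centralizer_singleton_iff, ← map_mul, ← map_mul,
        Subgroup.mem_center_iff.mp hz x]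
    · rw [Subgroup.mem_centralizer_singleton_iff] at hy ⊢
      exact (commute_of_commute_pow isUniquelyDivisible hn hy.symm).symm
  exact Subgroup.mem_centralizer_singleton_iff.mp hg

theorem mem_center_of_pow_mem {H : Type*} [Group H] (hH : IsUniquelyDivisible H) {n : ℕ}
    (hn : n ≠ 0) {y : H} (hy : y ^ n ∈ Subgroup.center H) : y ∈ Subgroup.center H := by
  rw [Subgroup.mem_center_iff] at hy ⊢
  exact fun g => commute_of_commute_pow hH hn (hy g)

theorem isUniquelyDivisible_quotient {H : Type*} [Group H] (hH : IsUniquelyDivisible H)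
    (Z : Subgroup H) [Z.Normal] (hZ : Z ≤ Subgroup.center H)
    (hroot : ∀ (n : ℕ) (y : H), n ≠ 0 → y ^ n ∈ Z → y ∈ Z) : IsUniquelyDivisible (H ⧸ Z) := by
  intro n hn
  constructor
  · rintro ⟨x⟩ ⟨y⟩ hxy
    have h1 : (x ^ n)⁻¹ * y ^ n ∈ Z := by
      rw [← QuotientGroup.eq]
      exact hxy
    obtain ⟨w, hw⟩ := (hH n hn).2 ((x ^ n)⁻¹ * y ^ n)
    have hw' : w ^ n = (x ^ n)⁻¹ * y ^ n := hw
    have hwZ : w ∈ Z := hroot n w hn (hw' ▸ h1)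
    have h2 : (x * w) ^ n = y ^ n := by
      rw [Commute.mul_pow (Subgroup.mem_center_iff.mp (hZ hwZ) x), hw', mul_inv_cancel_left]
    have h3 : x * w = y := (hH n hn).1 h2
    refine QuotientGroup.eq.mpr ?_
    rw [← h3, inv_mul_cancel_left]
    exact hwZ
  · rintro ⟨x⟩
    obtain ⟨w, hw⟩ := (hH n hn).2 x
    exact ⟨QuotientGroup.mk w, congrArg (QuotientGroup.mk (s := Z)) hw⟩

/-- The kernel of the map of Malcev completions induced by a central extension consists of roots
of elements of the kernel. -/
theorem exists_pow_eq_of (f : N →* Q) (hf : Function.Surjective f)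
    (hc : f.ker ≤ Subgroup.center N) {p : MalcevCompletion N} (hp : map f p = 1) :
    ∃ k : ℕ, k ≠ 0 ∧ ∃ z ∈ f.ker, p ^ k = of z := by
  have hcent (p : MalcevCompletion N) (h : ∃ k : ℕ, k ≠ 0 ∧ ∃ z ∈ f.ker, p ^ k = of z) :
      p ∈ Subgroup.center (MalcevCompletion N) := by
    obtain ⟨k, hk, z, hz, h⟩ := h
    exact mem_center_of_pow_mem isUniquelyDivisible hk (h ▸ of_mem_center (hc hz))
  let Z : Subgroup (MalcevCompletion N) :=
    { carrier := {p | ∃ k : ℕ, k ≠ 0 ∧ ∃ z ∈ f.ker, p ^ k = of z}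
      one_mem' := ⟨1, one_ne_zero, 1, one_mem _, by simp⟩
      mul_mem' := by
        rintro a b ⟨k, hk, z, hz, ha⟩ ⟨l, hl, w, hw, hb⟩
        have hb' := Subgroup.mem_center_iff.mp (hcent b ⟨l, hl, w, hw, hb⟩)
        refine ⟨k * l, mul_ne_zero hk hl, z ^ l * w ^ k, mul_mem (pow_mem hz l) (pow_mem hw k), ?_⟩
        rw [Commute.mul_pow (hb' a), pow_mul, ha, mul_comm k l, pow_mul, hb, map_mul, map_pow,
          map_pow]
      inv_mem' := by
        rintro a ⟨k, hk, z, hz, ha⟩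
        exact ⟨k, hk, z⁻¹, inv_mem hz, by rw [inv_pow, ha, map_inv]⟩ }
  have hZ : Z ≤ Subgroup.center (MalcevCompletion N) := hcent
  have : Z.Normal := ⟨fun z hz g => by
    rwa [Subgroup.mem_center_iff.mp (hZ hz) g, mul_inv_cancel_right]⟩
  have hquot : IsUniquelyDivisible (MalcevCompletion N ⧸ Z) := by
    refine isUniquelyDivisible_quotient isUniquelyDivisible Z hZ ?_
    rintro n y hn ⟨k, hk, z, hz, h⟩
    exact ⟨n * k, mul_ne_zero hn hk, z, hz, by rw [pow_mul, h]⟩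
  -- Since `N → MalcevCompletion N ⧸ Z` kills `f.ker` and the target is uniquely divisible, the
  -- projection modulo `Z` factors through `map f`. Hence the kernel of `map f` is contained in `Z`.
  let g : Q →* MalcevCompletion N ⧸ Z := f.liftOfSurjective hf
    ⟨(QuotientGroup.mk' Z).comp of, fun z hz => by
      rw [MonoidHom.mem_ker, MonoidHom.comp_apply]
      exact (QuotientGroup.eq_one_iff _).mpr ⟨1, one_ne_zero, z, hz, pow_one _⟩⟩
  have hg (x : N) : g (f x) = QuotientGroup.mk' Z (of x) :=
    MonoidHom.liftOfRightInverse_comp_apply _ _ _ _ x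
  have key : (lift hquot g).comp (map f) = QuotientGroup.mk' Z :=
    hom_ext hquot fun x => hg x
  have h := DFunLike.congr_fun key p
  rw [MonoidHom.comp_apply, hp, map_one] at h
  exact (QuotientGroup.eq_one_iff p).mp h.symm

theorem subsingleton [Subsingleton N] : Subsingleton (MalcevCompletion N) := by
  refine subsingleton_of_forall_eq 1 fun p => ?_
  refine mem_of_closed ⊥ (fun x => ?_) (fun n y hn hy => ?_) p
  · rw [Subsingleton.elim x 1, map_one]
    exact one_mem _
  · rw [Subgroup.mem_bot] at hy ⊢
    exact (isUniquelyDivisible n hn).1 (by simpa using hy)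

end MalcevCompletion

/-! ### The lower rational central series -/

section Series

variable {G : Type u} [Group G]

/-- An element dies after tensoring with `ℚ` exactly when it is torsion. -/
theorem mem_rationalCentralStep_iff (H : Subgroup G) [H.Normal] (x : G) :
    x ∈ rationalCentralStep H ↔ x ∈ H ∧ ∃ k : ℕ, k ≠ 0 ∧ x ^ k ∈ ⁅H, (⊤ : Subgroup G)⁆ := by
  have key (h : H) : toRationalCentralQuotient H h = 1 ↔
      ∃ k : ℕ, k ≠ 0 ∧ (h : G) ^ k ∈ ⁅H, (⊤ : Subgroup G)⁆ := by
    have h1 : toRationalCentralQuotient H h = 1 ↔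
        (1 : ℚ) ⊗ₜ[ℤ] Additive.ofMul (QuotientGroup.mk h : CentralQuotient H) = 0 := by
      rw [← (TensorProduct.comm ℤ _ _).map_eq_zero_iff, TensorProduct.comm_tmul]
      rfl
    rw [h1, one_tmul_eq_zero_iff]
    refine exists_congr fun k => and_congr_right fun _ => ?_
    rw [← ofMul_pow, ofMul_eq_zero, ← QuotientGroup.mk_pow, QuotientGroup.eq_one_iff,
      Subgroup.mem_subgroupOf, Subgroup.coe_pow]
  constructor
  · rintro ⟨h, hh, rfl⟩
    exact ⟨h.2, (key h).mp hh⟩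
  · rintro ⟨hx, h⟩
    exact ⟨⟨x, hx⟩, (key ⟨x, hx⟩).mpr h, rfl⟩

theorem mem_rationalLCS_succ_iff (i : ℕ) (x : G) : x ∈ rationalLCS G (i + 1) ↔
    x ∈ rationalLCS G i ∧ ∃ k : ℕ, k ≠ 0 ∧ x ^ k ∈ ⁅rationalLCS G i, (⊤ : Subgroup G)⁆ := by
  rw [rationalLCS_succ]
  exact mem_rationalCentralStep_iff _ x

theorem commutator_rationalLCS_le (i : ℕ) :
    ⁅rationalLCS G i, (⊤ : Subgroup G)⁆ ≤ rationalLCS G (i + 1) := fun x hx =>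
  (mem_rationalLCS_succ_iff i x).mpr
    ⟨Subgroup.commutator_le_left _ _ hx, 1, one_ne_zero, by rwa [pow_one]⟩

theorem rationalLCS_antitone : Antitone (rationalLCS G) :=
  antitone_nat_of_succ_le rationalLCS_succ_le

variable (G) in
/-- The projection `G / γ (i + 1) → G / γ i`. -/
def quotientTransition (i : ℕ) : G ⧸ rationalLCS G (i + 1) →* G ⧸ rationalLCS G i :=
  QuotientGroup.map (rationalLCS G (i + 1)) (rationalLCS G i) (MonoidHom.id G)
    (rationalLCS_succ_le i)

theorem quotientTransition_surjective (i : ℕ) : Function.Surjective (quotientTransition G i) := by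
  rintro ⟨g⟩
  exact ⟨QuotientGroup.mk g, rfl⟩

theorem ker_quotientTransition_le (i : ℕ) :
    (quotientTransition G i).ker ≤ Subgroup.center (G ⧸ rationalLCS G (i + 1)) := by
  rintro ⟨z⟩ hz
  have hz' : z ∈ rationalLCS G i := (QuotientGroup.eq_one_iff z).mp hz
  refine Subgroup.mem_center_iff.mpr ?_
  rintro ⟨g⟩
  refine QuotientGroup.eq.mpr ?_
  have h : ⁅z⁻¹, g⁻¹⁆ ∈ rationalLCS G (i + 1) := commutator_rationalLCS_le i
    (Subgroup.commutator_mem_commutator (inv_mem hz') (Subgroup.mem_top _))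
  simpa [commutatorElement_def, mul_assoc] using h

/-- The homomorphism of quotients given by an inclusion of terms of the series. -/
def quotientMapOfLE {i j : ℕ} (h : rationalLCS G i ≤ rationalLCS G j) :
    G ⧸ rationalLCS G i →* G ⧸ rationalLCS G j :=
  QuotientGroup.map (rationalLCS G i) (rationalLCS G j) (MonoidHom.id G) h

variable (G) in
/-- The projection of the `ℚ`-completion to a stage of the tower. -/
def evalRationalCompletion (N : ℕ) :
    RationalCompletion G →* MalcevCompletion (G ⧸ rationalLCS G N) :=
  (Pi.evalMonoidHom _ N).comp (RationalCompletion G).subtype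

/-- From stage `N` on the series is constant, so the transition maps there are invertible; the
stages below are images of stage `N`. -/
theorem evalRationalCompletion_bijective {N : ℕ} (hN : ∀ i, rationalLCS G N ≤ rationalLCS G i) :
    Function.Bijective (evalRationalCompletion G N) := by
  constructor
  · rw [injective_iff_map_eq_one]
    rintro ⟨x, hx⟩ (h : x N = 1)
    have hle (i : ℕ) (hi : i ≤ N) : x i = 1 := by
      induction hi using Nat.decreasingInduction with
      | self => exact h
      | of_succ i _ ih => rw [← hx i, ih, map_one]
    have hge (i : ℕ) (hi : N ≤ i) : x i = 1 := by
      induction i, hi using Nat.le_induction with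
      | base => exact h
      | succ i hi ih =>
        let f : G ⧸ rationalLCS G i →* G ⧸ rationalLCS G (i + 1) :=
          quotientMapOfLE ((rationalLCS_antitone hi).trans (hN (i + 1)))
        have hf : (MalcevCompletion.map f).comp (completionTransition G i) = MonoidHom.id _ :=
          MalcevCompletion.hom_ext MalcevCompletion.isUniquelyDivisible
            (by rintro ⟨g⟩; rfl)
        have h1 := DFunLike.congr_fun hf (x (i + 1))
        rw [MonoidHom.comp_apply, hx i, ih, map_one] at h1
        exact h1.symm
    refine Subtype.ext (funext fun i => ?_)
    rcases le_total i N with hi | hi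
    · exact hle i hi
    · exact hge i hi
  · intro p
    refine ⟨⟨fun i => MalcevCompletion.map
      (quotientMapOfLE (hN i)) p, fun i => ?_⟩, ?_⟩
    · have h : (completionTransition G i).comp (MalcevCompletion.map
          (quotientMapOfLE (hN (i + 1)))) = MalcevCompletion.map
          (quotientMapOfLE (hN i)) :=
        MalcevCompletion.hom_ext MalcevCompletion.isUniquelyDivisible (by rintro ⟨g⟩; rfl)
      exact DFunLike.congr_fun h p
    · have h : MalcevCompletion.map (quotientMapOfLE (hN N)) =
          MonoidHom.id (MalcevCompletion (G ⧸ rationalLCS G N)) :=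
        MalcevCompletion.hom_ext MalcevCompletion.isUniquelyDivisible (by rintro ⟨g⟩; rfl)
      exact DFunLike.congr_fun h p

end Series

/-! ### The rational series and the completion of `M ⋊ C` -/

section Metabelian

variable {M : Type u} [AddCommGroup M] [DistribMulAction InfCyclic M]

theorem commutator_right (x y : MetabelianOverC M) : (⁅x, y⁆ : MetabelianOverC M).right = 1 := by
  simp [commutatorElement_def, mul_comm x.right]

theorem toRatModule_commutator_left (x y : MetabelianOverC M) :
    toRatModule M (⁅x, y⁆ : MetabelianOverC M).left.toAdd =
      (MonoidAlgebra.of ℚ InfCyclic x.right - 1) • toRatModule M y.left.toAdd -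
        (MonoidAlgebra.of ℚ InfCyclic y.right - 1) • toRatModule M x.left.toAdd := by
  have h : (⁅x, y⁆ : MetabelianOverC M).left.toAdd = x.left.toAdd + x.right • y.left.toAdd -
      y.right • x.left.toAdd - y.left.toAdd := by
    have h1 : ⁅x, y⁆ * y = x * y * x⁻¹ := by
      rw [commutatorElement_def, inv_mul_cancel_right]
    have h2 := congrArg (fun g : MetabelianOverC M => g.left.toAdd) h1
    have h3 : (⁅x, y⁆ * y).left.toAdd = (⁅x, y⁆ : MetabelianOverC M).left.toAdd +
        (⁅x, y⁆ : MetabelianOverC M).right • y.left.toAdd := rfl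
    have h4 : (x * y * x⁻¹).left.toAdd = x.left.toAdd + x.right • y.left.toAdd +
        (x.right * y.right) • x.right⁻¹ • -x.left.toAdd := rfl
    rw [commutator_right, one_smul] at h3
    rw [smul_smul, mul_comm x.right, mul_inv_cancel_right, smul_neg] at h4
    rw [eq_sub_iff_add_eq, ← h3, h1, h4]
    abel
  rw [h, map_sub, map_sub, map_add, toRatModule_smul, toRatModule_smul, sub_smul, sub_smul,
    one_smul, one_smul]
  abel

/-- For `i = 0` nothing is assumed about `H`: both coefficients in the commutator formula already
lie in `I`. Later on, elements of `H` have trivial `C`-coordinate, and only one term survives, lying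
one step deeper in the filtration. -/
theorem commutator_le_ker (i : ℕ) (H : Subgroup (MetabelianOverC M))
    (hH : ∀ x ∈ H, i = 0 ∨ metabelianToTrunc M i x = 1) :
    ⁅H, (⊤ : Subgroup (MetabelianOverC M))⁆ ≤ (metabelianToTrunc M (i + 1)).ker := by
  rw [Subgroup.commutator_le]
  intro x hx y _
  rw [MonoidHom.mem_ker, metabelianToTrunc_eq_one_iff]
  refine ⟨commutator_right x y, ?_⟩
  rw [toRatModule_commutator_left]
  rcases hH x hx with rfl | h
  · exact sub_mem (smul_mem_augFiltration_succ (by simp [augFiltration]) (of_sub_one_mem _))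
      (smul_mem_augFiltration_succ (by simp [augFiltration]) (of_sub_one_mem _))
  · rw [metabelianToTrunc_eq_one_iff] at h
    rw [h.1, map_one, sub_self, zero_smul, zero_sub]
    exact neg_mem (smul_mem_augFiltration_succ h.2 (of_sub_one_mem _))

/-- Over `ℚ` the module coordinate of `x` is `(t - 1) w` with `w` one step higher. A multiple `k w`
comes from some `y ∈ M`, and `⁅y, t⁆` agrees with `x ^ (-k)` up to torsion, which the further
exponent `l` removes. -/
theorem exists_pow_mem_commutator (i : ℕ) (H : Subgroup (MetabelianOverC M))
    (hH : ∀ x, metabelianToTrunc M i x = 1 → x ∈ H) (x : MetabelianOverC M)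
    (hx : metabelianToTrunc M (i + 1) x = 1) :
    ∃ k : ℕ, k ≠ 0 ∧ x ^ k ∈ ⁅H, (⊤ : Subgroup (MetabelianOverC M))⁆ := by
  rw [metabelianToTrunc_eq_one_iff, mem_augFiltration_succ] at hx
  obtain ⟨hx1, w, hw, hwx⟩ := hx
  obtain ⟨k, hk, n, hn⟩ := exists_nsmul_eq_toRatModule w
  let y : MetabelianOverC M := SemidirectProduct.inl (Multiplicative.ofAdd n)
  let t : MetabelianOverC M := SemidirectProduct.inr (Multiplicative.ofAdd 1)
  have hy : y ∈ H := hH y ((metabelianToTrunc_eq_one_iff i y).mpr ⟨rfl, by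
    change toRatModule M n ∈ _
    rw [hn]
    exact nsmul_mem hw k⟩)
  have hc : ⁅y, t⁆ ∈ ⁅H, (⊤ : Subgroup (MetabelianOverC M))⁆ :=
    Subgroup.commutator_mem_commutator hy (Subgroup.mem_top t)
  have hcV : toRatModule M (⁅y, t⁆ : MetabelianOverC M).left.toAdd =
      -(k • toRatModule M x.left.toAdd) := by
    rw [toRatModule_commutator_left]
    change (_ : RatGroupRing) • toRatModule M 0 - tSubOne • toRatModule M n = _
    rw [map_zero, smul_zero, zero_sub, hn, ← hwx, smul_comm]
  obtain ⟨l, hl, h0⟩ := (toRatModule_eq_zero_iff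
    (k • x.left.toAdd + (⁅y, t⁆ : MetabelianOverC M).left.toAdd)).mp (by
      rw [map_add, map_nsmul, hcV, add_neg_cancel])
  have hxl : x = SemidirectProduct.inl x.left := SemidirectProduct.ext rfl hx1
  have hcl : ⁅y, t⁆ = SemidirectProduct.inl (⁅y, t⁆ : MetabelianOverC M).left :=
    SemidirectProduct.ext rfl (commutator_right y t)
  refine ⟨k * l, mul_ne_zero hk hl, ?_⟩
  have h1 : x ^ (k * l) * ⁅y, t⁆ ^ l = 1 := by
    rw [hxl, hcl, ← map_pow, ← map_pow, ← map_mul, pow_mul, ← mul_pow]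
    have h2 : (x.left ^ k * (⁅y, t⁆ : MetabelianOverC M).left) ^ l = 1 :=
      Multiplicative.toAdd.injective h0
    rw [h2, map_one]
  rw [eq_inv_of_mul_eq_one_left h1]
  exact inv_mem (pow_mem hc l)

theorem metabelianToTrunc_eq_one_of_succ {i : ℕ} {x : MetabelianOverC M}
    (hx : metabelianToTrunc M (i + 1) x = 1) : metabelianToTrunc M i x = 1 := by
  rw [metabelianToTrunc_eq_one_iff] at hx ⊢
  exact ⟨hx.1, augFiltration_antitone (Nat.le_succ i) hx.2⟩

theorem mem_rationalLCS_metabelian (i : ℕ) (x : MetabelianOverC M) :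
    x ∈ rationalLCS (MetabelianOverC M) (i + 1) ↔ metabelianToTrunc M (i + 1) x = 1 := by
  have step (i : ℕ)
      (h1 : ∀ x ∈ rationalLCS (MetabelianOverC M) i, i = 0 ∨ metabelianToTrunc M i x = 1)
      (h2 : ∀ x, metabelianToTrunc M i x = 1 → x ∈ rationalLCS (MetabelianOverC M) i)
      (x : MetabelianOverC M) :
      x ∈ rationalLCS (MetabelianOverC M) (i + 1) ↔ metabelianToTrunc M (i + 1) x = 1 := by
    rw [mem_rationalLCS_succ_iff]
    constructor
    · rintro ⟨-, k, hk, hxk⟩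
      have h := commutator_le_ker i _ h1 hxk
      rw [MonoidHom.mem_ker, map_pow] at h
      -- Uniqueness of roots in the target makes the kernel closed under roots.
      exact (isUniquelyDivisible_truncSemidirect i k hk).1 (h.trans (one_pow k).symm)
    · exact fun h => ⟨h2 x (metabelianToTrunc_eq_one_of_succ h),
        exists_pow_mem_commutator i _ h2 x h⟩
  induction i generalizing x with
  | zero => exact step 0 (fun _ _ => Or.inl rfl) (fun x _ => Subgroup.mem_top x) x
  | succ i ih => exact step (i + 1) (fun x hx => Or.inr ((ih x).mp hx)) (fun x => (ih x).mpr) x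

variable (M) in
/-- The injection of `G / γ (i + 1)` into `(M ⊗ ℚ / I ^ (i + 1)) ⋊ ℚ`. -/
def quotientToTrunc (i : ℕ) : MetabelianOverC M ⧸ rationalLCS (MetabelianOverC M) (i + 1) →*
    TruncSemidirect (RatModule M) (i + 1) :=
  QuotientGroup.lift (rationalLCS (MetabelianOverC M) (i + 1)) (metabelianToTrunc M (i + 1))
    fun x hx => (mem_rationalLCS_metabelian i x).mp hx

theorem quotientToTrunc_eq_one {i : ℕ}
    {z : MetabelianOverC M ⧸ rationalLCS (MetabelianOverC M) (i + 1)}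
    (hz : quotientToTrunc M i z = 1) : z = 1 := by
  obtain ⟨g, rfl⟩ := QuotientGroup.mk_surjective z
  exact (QuotientGroup.eq_one_iff g).mpr ((mem_rationalLCS_metabelian i g).mpr hz)

variable (M) in
/-- The comparison of the Malcev completion of `G / γ (i + 1)` with
`(M ⊗ ℚ / I ^ (i + 1)) ⋊ ℚ`. -/
def malcevToTrunc (i : ℕ) :
    MalcevCompletion (MetabelianOverC M ⧸ rationalLCS (MetabelianOverC M) (i + 1)) →*
      TruncSemidirect (RatModule M) (i + 1) :=
  MalcevCompletion.lift (isUniquelyDivisible_truncSemidirect i) (quotientToTrunc M i)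

theorem malcevToTrunc_of (i : ℕ) (g : MetabelianOverC M) :
    malcevToTrunc M i (MalcevCompletion.of (QuotientGroup.mk g)) = metabelianToTrunc M (i + 1) g :=
  rfl

theorem malcevToTrunc_transition (i : ℕ)
    (p : MalcevCompletion (MetabelianOverC M ⧸ rationalLCS (MetabelianOverC M) (i + 2))) :
    malcevToTrunc M i (MalcevCompletion.map (quotientTransition _ (i + 1)) p) =
      truncSemidirectTransition (i + 1) (malcevToTrunc M (i + 1) p) := by
  have h : (malcevToTrunc M i).comp (MalcevCompletion.map (quotientTransition _ (i + 1))) =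
      (truncSemidirectTransition (i + 1)).comp (malcevToTrunc M (i + 1)) :=
    MalcevCompletion.hom_ext (isUniquelyDivisible_truncSemidirect i) (by rintro ⟨g⟩; rfl)
  exact DFunLike.congr_fun h p

/-- By induction an element of the kernel dies one stage lower, so some power of it comes from an
element `z` of the quotient of `G`. The comparison is injective on that quotient, so `z = 1`, and
the only root of `1` is `1`. -/
theorem malcevToTrunc_injective (i : ℕ) : Function.Injective (malcevToTrunc M i) := by
  have step (i : ℕ)
      (p : MalcevCompletion (MetabelianOverC M ⧸ rationalLCS (MetabelianOverC M) (i + 1)))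
      (hp : malcevToTrunc M i p = 1)
      (h : MalcevCompletion.map (quotientTransition _ i) p = 1) : p = 1 := by
    obtain ⟨k, hk, z, -, hz⟩ := MalcevCompletion.exists_pow_eq_of (quotientTransition _ i)
      (quotientTransition_surjective i) (ker_quotientTransition_le i) h
    have hz1 : quotientToTrunc M i z = 1 := by
      have h1 : malcevToTrunc M i (MalcevCompletion.of z) = 1 := by
        rw [← hz, map_pow, hp, one_pow]
      exact h1
    rw [quotientToTrunc_eq_one hz1, map_one] at hz
    exact (MalcevCompletion.isUniquelyDivisible k hk).1 (hz.trans (one_pow k).symm)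
  induction i with
  | zero =>
    rw [injective_iff_map_eq_one]
    intro p hp
    have : Subsingleton (MetabelianOverC M ⧸ rationalLCS (MetabelianOverC M) 0) :=
      QuotientGroup.subsingleton_quotient_top
    have := MalcevCompletion.subsingleton
      (N := MetabelianOverC M ⧸ rationalLCS (MetabelianOverC M) 0)
    exact step 0 p hp (Subsingleton.elim _ _)
  | succ i ih =>
    rw [injective_iff_map_eq_one] at ih ⊢
    intro p hp
    refine step (i + 1) p hp (ih _ ?_)
    rw [malcevToTrunc_transition, hp, map_one]

/-- The image is closed under roots, and each factor of the semidirect product consists of roots of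
elements coming from `M` or from `C`. -/
theorem malcevToTrunc_surjective (i : ℕ) : Function.Surjective (malcevToTrunc M i) := by
  have hroot (n : ℕ) (y : TruncSemidirect (RatModule M) (i + 1)) (hn : n ≠ 0)
      (hy : y ^ n ∈ (malcevToTrunc M i).range) : y ∈ (malcevToTrunc M i).range := by
    obtain ⟨p, hp⟩ := hy
    obtain ⟨q, hq⟩ := (MalcevCompletion.isUniquelyDivisible n hn).2 p
    refine ⟨q, (isUniquelyDivisible_truncSemidirect i n hn).1 ?_⟩
    change malcevToTrunc M i q ^ n = y ^ n
    rw [← map_pow, ← hp]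
    exact congrArg _ hq
  have hG (g : MetabelianOverC M) : metabelianToTrunc M (i + 1) g ∈ (malcevToTrunc M i).range :=
    ⟨_, malcevToTrunc_of i g⟩
  intro y
  rw [← SemidirectProduct.inl_left_mul_inr_right y]
  refine (malcevToTrunc M i).range.mul_mem ?_ ?_
  · obtain ⟨v, hv⟩ := Submodule.mkQ_surjective _ y.left.toAdd
    obtain ⟨k, hk, m, hm⟩ := exists_nsmul_eq_toRatModule v
    refine hroot k _ hk ?_
    have h : SemidirectProduct.inl y.left ^ k =
        metabelianToTrunc M (i + 1) (SemidirectProduct.inl (Multiplicative.ofAdd m)) := by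
      rw [← map_pow]
      refine SemidirectProduct.ext (Multiplicative.toAdd.injective ?_) (map_one intToRat).symm
      rw [toAdd_metabelianToTrunc_left]
      change k • y.left.toAdd = Submodule.mkQ _ (toRatModule M m)
      rw [← hv, hm, map_nsmul]
    rw [h]
    exact hG _
  · refine hroot y.right.toAdd.den _ y.right.toAdd.den_nz ?_
    have h : SemidirectProduct.inr y.right ^ y.right.toAdd.den =
        metabelianToTrunc M (i + 1)
          (SemidirectProduct.inr (Multiplicative.ofAdd y.right.toAdd.num)) := by
      rw [← map_pow]
      refine SemidirectProduct.ext (Multiplicative.toAdd.injective ?_)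
        (Multiplicative.toAdd.injective ?_)
      · rw [toAdd_metabelianToTrunc_left]
        change 0 = Submodule.mkQ _ (toRatModule M 0)
        rw [map_zero, map_zero]
      · change y.right.toAdd.den • y.right.toAdd = (y.right.toAdd.num : ℚ)
        rw [nsmul_eq_mul, Rat.den_mul_eq_num]
    rw [h]
    exact hG _

theorem eval_ratPow_smul (i : ℕ) (α : ℚ) (x : RatModuleCompletion M) :
    AdicCompletion.eval augIdeal (RatModule M) i (ratPow α • x) =
      truncPow α i • AdicCompletion.eval augIdeal (RatModule M) i x := by
  rw [AdicCompletion.eval_apply, AdicCompletion.smul_eval, AdicCompletion.eval_apply]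
  obtain ⟨w, hw⟩ := Submodule.mkQ_surjective _ (x.val i)
  rw [← hw]
  rfl

variable (M) in
/-- The projection of `(M ⊗ ℚ)^_I ⋊ ℚ` to a truncation. -/
def ratSemidirectToTrunc (i : ℕ) : RatSemidirect M →* TruncSemidirect (RatModule M) i :=
  SemidirectProduct.map
    (AdicCompletion.eval augIdeal (RatModule M) i).toAddMonoidHom.toMultiplicative
    (MonoidHom.id _) fun α => by
    refine MonoidHom.ext fun (x : RatModuleCompletion M) => ?_
    exact congrArg Multiplicative.ofAdd (eval_ratPow_smul i α.toAdd x)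

/-- Beyond stage `N` the quotients no longer change, and those below are quotients of the `N`-th. -/
theorem eval_bijective {N : ℕ}
    (hN : ∀ i, N ≤ i → augFiltration (RatModule M) i = augFiltration (RatModule M) N) :
    Function.Bijective (AdicCompletion.eval augIdeal (RatModule M) N) := by
  refine ⟨?_, AdicCompletion.eval_surjective _ _ _⟩
  rw [injective_iff_map_eq_zero]
  intro x hx
  refine AdicCompletion.ext fun i => ?_
  have key (i : ℕ) (hi : N ≤ i) : x.val i = 0 := by
    obtain ⟨w, hw⟩ := Submodule.mkQ_surjective _ (x.val i)
    have h := x.2 hi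
    rw [← hw] at h ⊢
    have h' : (augFiltration (RatModule M) N).mkQ w = 0 := h.trans hx
    rw [Submodule.mkQ_apply, Submodule.Quotient.mk_eq_zero] at h' ⊢
    rw [← hN i hi] at h'
    exact h'
  have h := x.2 (le_max_right N i)
  rw [← h, key _ (le_max_left N i), map_zero]
  rfl

theorem ratSemidirectToTrunc_bijective {N : ℕ}
    (hN : ∀ i, N ≤ i → augFiltration (RatModule M) i = augFiltration (RatModule M) N) :
    Function.Bijective (ratSemidirectToTrunc M N) := by
  have hb := eval_bijective hN
  constructor
  · intro x y h
    have hl : (ratSemidirectToTrunc M N x).left = (ratSemidirectToTrunc M N y).left := by rw [h]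
    have hr : (ratSemidirectToTrunc M N x).right = (ratSemidirectToTrunc M N y).right := by rw [h]
    exact SemidirectProduct.ext (hb.1 hl) hr
  · intro y
    obtain ⟨x, hx⟩ := hb.2 y.left.toAdd
    exact ⟨⟨Multiplicative.ofAdd x, y.right⟩, SemidirectProduct.ext hx rfl⟩

end Metabelian

/-- The `ℚ`-completion is a truncation as soon as the filtration is stationary. -/
theorem exists_rationalCompletion_equiv {M : Type u} [AddCommGroup M]
    [DistribMulAction InfCyclic M] {N : ℕ}
    (hN : ∀ i, N + 1 ≤ i →
      augFiltration (RatModule M) i = augFiltration (RatModule M) (N + 1)) :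
    ∃ e : RationalCompletion (MetabelianOverC M) ≃* TruncSemidirect (RatModule M) (N + 1),
      ∀ g, e (toRationalCompletion (MetabelianOverC M) g) = metabelianToTrunc M (N + 1) g := by
  have hle (i : ℕ) : rationalLCS (MetabelianOverC M) (N + 1) ≤
      rationalLCS (MetabelianOverC M) i := by
    rcases le_total i (N + 1) with hi | hi
    · exact rationalLCS_antitone hi
    · obtain ⟨i, rfl⟩ : ∃ j, i = j + 1 := ⟨i - 1, by omega⟩
      intro x hx
      rw [mem_rationalLCS_metabelian, metabelianToTrunc_eq_one_iff] at hx ⊢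
      rwa [hN _ hi]
  exact ⟨(MulEquiv.ofBijective _ (evalRationalCompletion_bijective hle)).trans
    (MulEquiv.ofBijective (malcevToTrunc M N)
      ⟨malcevToTrunc_injective N, malcevToTrunc_surjective N⟩), fun g => rfl⟩

theorem mainTheorem5 (M : Type) [AddCommGroup M] [DistribMulAction InfCyclic M]
    (hM : Module.Finite ℚ (TensorProduct ℤ ℚ M)) :
    (∃ e : RationalCompletion (MetabelianOverC M) ≃* RatSemidirect M,
      ∀ g : MetabelianOverC M,
        e (toRationalCompletion (MetabelianOverC M) g) =
          ⟨Multiplicative.ofAdd (toRatModuleCompletion M (Multiplicative.toAdd g.left)),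
            Multiplicative.ofAdd ((Multiplicative.toAdd g.right : ℤ) : ℚ)⟩) ∧
    ∀ n : ℕ, Function.Surjective
      (rationalHomologyMap (toRationalCompletion (MetabelianOverC M)) n) := by
  obtain ⟨_, _⟩ := isArtinian_ratModule hM
  obtain ⟨N, hN1, hN, s, hs⟩ := exists_stable_augFiltration (W := RatModule M)
  obtain ⟨N, rfl⟩ : ∃ k, N = k + 1 := ⟨N - 1, by omega⟩
  obtain ⟨e, he⟩ := exists_rationalCompletion_equiv hN
  -- Both groups are identified with the same truncation, where the two canonical maps from `G`
  -- agree by definition.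
  refine ⟨⟨e.trans (MulEquiv.ofBijective _ (ratSemidirectToTrunc_bijective hN)).symm,
    fun g => ?_⟩, ?_⟩
  · rw [MulEquiv.trans_apply, he, MulEquiv.symm_apply_eq]
    rfl
  · have h1 := rationalHomologySurjective_metabelianToTrunc hM (N + 1) s hs
    have h2 : RationalHomologySurjective e.symm.toMonoidHom :=
      RationalHomologySurjective.of_rightInverse e.toMonoidHom
        (MonoidHom.ext fun x => e.symm_apply_apply x)
    have h3 : toRationalCompletion (MetabelianOverC M) =
        e.symm.toMonoidHom.comp (metabelianToTrunc M (N + 1)) :=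
      MonoidHom.ext fun g => (e.symm_apply_eq.mpr (he g).symm).symm
    rw [h3]
    exact h2.comp h1

end
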